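/- Let $G$ be a finite simple graph with maximum degree $\Delta$. A \emph{strong clique} of $G$ is a set of edges of $G$ every two distinct members of which share an endpoint or are connected by an edge of $G$, and the \emph{strong clique number} $\omega_2'(G)$ is the largest cardinality of a strong clique of $G$. For a set $\mathcal{F}$ of cycles, $G$ is called $\mathcal{F}$-free if it contains no (not necessarily induced) subgraph isomorphic to a member of $\mathcal{F}$; $C_\ell$ denotes the cycle with $\ell$ vertices. (i) If $G$ is $C_4$-free and $\Delta\ge 4$, then $\omega_2'(G)\le 3(\Delta-1)$. (ii) If $G$ is $C_{2k}$-free for an integer $k\ge 3$ and $\Delta\ge 2$, then $\omega_2'(G)\le 10k^2(\Delta-1)$. (iii) If $G$ is $\{C_{2k},C_{2k+1},C_{2k+2}\}$-free for an integer $k\ge 2$ and $\Delta\ge 1$, then $\omega_2'(G)\le (2k-1)(\Delta-1)+2$. -/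

import Mathlib

/-- A strong clique of `G`: a set of edges of `G` any two distinct members of which are incident
(share an endpoint) or are connected by an edge of `G`. -/
def IsStrongClique {V : Type*} (G : SimpleGraph V) (S : Set (Sym2 V)) : Prop :=
  S ⊆ G.edgeSet ∧
    ∀ e ∈ S, ∀ f ∈ S, e ≠ f →
      (∃ v, v ∈ e ∧ v ∈ f) ∨ (∃ a ∈ e, ∃ b ∈ f, G.Adj a b)

/-- The strong clique number of a finite graph `G`: the largest cardinality of a strong clique. -/
noncomputable def strongCliqueNumber {V : Type*} [Fintype V] (G : SimpleGraph V) : ℕ :=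
  sSup {n : ℕ | ∃ S : Finset (Sym2 V), IsStrongClique G (S : Set (Sym2 V)) ∧ S.card = n}

/-- On a finite vertex set the supremum defining the strong clique number is a maximum. -/
theorem isGreatest_strongCliqueNumber {V : Type*} [Fintype V] (G : SimpleGraph V) :
    IsGreatest {n : ℕ | ∃ S : Finset (Sym2 V), IsStrongClique G (S : Set (Sym2 V)) ∧ S.card = n}
      (strongCliqueNumber G) := by
  classical
  have hb : BddAbove
      {n : ℕ | ∃ S : Finset (Sym2 V), IsStrongClique G (S : Set (Sym2 V)) ∧ S.card = n} := by
    refine ⟨Fintype.card (Sym2 V), ?_⟩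
    rintro n ⟨S, -, rfl⟩
    exact S.card_le_univ
  have hn : {n : ℕ | ∃ S : Finset (Sym2 V),
      IsStrongClique G (S : Set (Sym2 V)) ∧ S.card = n}.Nonempty :=
    ⟨0, ∅, by simp [IsStrongClique], by simp⟩
  exact ⟨Nat.sSup_mem hn hb, fun n h => le_csSup hb h⟩

/-!
A strong clique is treated as a subgraph `H` of `G` any two disjoint edges of which are joined by an
edge of `G`. In each case a small set of vertices meeting all edges of `H` is found.

*Three consecutive cycle lengths.* Consider paths of `G` whose first and last edges lie in `H`. The
two end edges are joined by an edge of `G`, so a path on `2k + 2` vertices would close a cycle of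
length `2k`, `2k + 1` or `2k + 2` (`IsCliquePath.length_ne`). An edge of `H` disjoint from the path
prolongs it by one or two vertices (`IsCliquePath.extend`). Hence a longest such path on at most
`2k + 1` vertices meets all edges of `H` and can be shortened to `2k - 1` vertices, unless it has
`2k + 1` vertices and misses an edge `ab` of `H`. In that case `ab` and the two end edges alternate
around a hexagon of `G`. This hexagon supplies detours of several lengths, and the same argument
applied to paths that start at one of its edges and avoid the rest of it again gives a path on at
most `2k - 1` vertices meeting all edges of `H` (`exists_path_meeting_of_hexagon`). A path on `m`
vertices is met by at most `m (Δ - 1) + 1` edges.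

*One even cycle.* The vertices of a maximum matching of `H` with `m` edges meet all edges of `H`,
which gives `|H| ≤ 2m (Δ - 1) + 1`. To bound `m`, fix a matching edge; one of its ends, `x`, has a
neighbour on at least half of the other matching edges. Between any two of these matching edges
runs an edge of `G`, so one of three graphs is dense: the one on the neighbours of `x`, the one on
their partners, or the bipartite one between them. A dense graph has long paths, and each kind of
path is closed to a cycle of length `2k` through `x` (`IsMatchingPairs.card_le_of_star`).

*Four-cycles.* Here two vertices have at most one common neighbour. A vertex on three edges of `H`
is on or adjacent to every edge of `H`, which settles the case that there is such a vertex.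
Otherwise `H` has maximum degree two, and two non-adjacent vertices of degree two in `H` have a
common neighbour in `H` (`exists_common_clique_neighbor`). Consequently no vertex has more than two
neighbours in `G` that have degree two in `H` (`card_neighbors_two_le_degree`), and this bounds the
number of edges of `H` around an edge of `H` that meets no other one
(`card_edgeFinset_of_isolated`) or, if there is none, around a vertex of degree two in `H`
(`card_edgeFinset_le_nine`).
-/

open SimpleGraph

/-! ### Cycles given by lists of vertices -/

/-- A list of at least three distinct vertices, consecutive ones adjacent and the last adjacent to
the first, is a cycle of `G`. -/
theorem cycleGraph_isContained_of_list {V : Type*} {G : SimpleGraph V} {a b : V} {l : List V}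
    (hchain : (a :: l).IsChain G.Adj) (hnodup : (a :: l).Nodup)
    (hlast : (a :: l).getLast? = some b) (hba : G.Adj b a) (hlen : 3 ≤ (a :: l).length) :
    (cycleGraph (a :: l).length).IsContained G := by
  generalize hL : a :: l = L at *
  have h0 : ∀ h : 0 < L.length, L[0] = a := by subst hL; simp
  have hl : ∀ h : L.length - 1 < L.length, L[L.length - 1] = b := by
    intro h
    rw [List.getLast?_eq_getElem?, List.getElem?_eq_getElem h] at hlast
    simpa using hlast
  have hstep := List.isChain_iff_getElem.1 hchain
  have key : ∀ u v : Fin L.length, (v - u).val = 1 → G.Adj L[u] L[v] := by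
    intro u v huv
    rw [Fin.val_sub] at huv
    have hu := u.2
    have hv := v.2
    rcases Nat.lt_or_ge (u.val + 1) L.length with h | h
    · have : v.val = u.val + 1 := by
        rcases Nat.lt_or_ge v.val u.val with h1 | h1
        · rw [Nat.mod_eq_of_lt (by omega)] at huv; omega
        · rw [show L.length - u.val + v.val = L.length + (v.val - u.val) by omega,
            Nat.add_mod_left, Nat.mod_eq_of_lt (by omega)] at huv
          omega
      simpa [this] using hstep u.val h
    · have hu' : u.val = L.length - 1 := by omega
      have hv' : v.val = 0 := by
        by_contra hne
        rcases Nat.lt_or_ge v.val u.val with h1 | h1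
        · rw [Nat.mod_eq_of_lt (by omega)] at huv; omega
        · rw [show L.length - u.val + v.val = L.length by omega, Nat.mod_self] at huv
          omega
      have e1 := h0 (by omega)
      have e2 := hl (by omega)
      simp only [Fin.getElem_fin, hu', hv']
      rw [e1, e2]; exact hba
  refine ⟨⟨⟨fun i => L[i], ?_⟩, ?_⟩⟩
  · intro u v huv
    rcases cycleGraph_adj'.1 huv with h | h
    · exact (key v u h).symm
    · exact key u v h
  · intro u v huv
    exact Fin.ext ((List.Nodup.getElem_inj_iff hnodup).1 huv)

/-- In a graph without four-cycles two distinct vertices have at most one common neighbour. -/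
theorem eq_of_common_neighbor {V : Type*} {G : SimpleGraph V} (hG : (cycleGraph 4).Free G)
    {a b c d : V} (hac : a ≠ c) (hab : G.Adj a b) (hcb : G.Adj c b) (had : G.Adj a d)
    (hcd : G.Adj c d) : b = d := by
  by_contra hbd
  refine hG (cycleGraph_isContained_of_list (a := a) (b := d) (l := [b, c, d]) ?_ ?_ ?_ had.symm
    (by simp))
  · simp [hab, hcb.symm, hcd]
  · simp [hab.ne, hac, had.ne, hcb.ne', hbd, hcd.ne]
  · simp

/-! ### Strong cliques and the edges meeting a vertex set -/

/-- `H` is a subgraph of `G` whose edges form a strong clique of `G`. -/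
def IsStrongCliqueGraph {V : Type*} (G H : SimpleGraph V) : Prop :=
  H ≤ G ∧ ∀ a b c d, H.Adj a b → H.Adj c d →
    (a = c ∨ a = d ∨ b = c ∨ b = d) ∨ (G.Adj a c ∨ G.Adj a d ∨ G.Adj b c ∨ G.Adj b d)

/-- Vertex-disjoint edges of a strong clique are joined by an edge of `G`. -/
theorem IsStrongCliqueGraph.adj_of_disjoint {V : Type*} {G H : SimpleGraph V}
    (h : IsStrongCliqueGraph G H) {a b c d : V} (hab : H.Adj a b) (hcd : H.Adj c d)
    (hac : a ≠ c) (had : a ≠ d) (hbc : b ≠ c) (hbd : b ≠ d) :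
    G.Adj a c ∨ G.Adj a d ∨ G.Adj b c ∨ G.Adj b d := by
  have := h.2 a b c d hab hcd
  tauto

section Meeting

open scoped Classical

variable {V : Type*} [Fintype V]

/-- The edges of `H` having at least one endpoint in `W`. -/
noncomputable def edgesMeeting (H : SimpleGraph V) (W : Finset V) : Finset (Sym2 V) :=
  Finset.univ.filter fun e => e ∈ H.edgeSet ∧ ∃ v ∈ W, v ∈ e

theorem mem_edgesMeeting {H : SimpleGraph V} {W : Finset V} {a b : V} :
    s(a, b) ∈ edgesMeeting H W ↔ H.Adj a b ∧ (a ∈ W ∨ b ∈ W) := by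
  simp only [edgesMeeting, Finset.mem_filter, Finset.mem_univ, true_and, mem_edgeSet, Sym2.mem_iff]
  refine and_congr_right fun _ => ⟨?_, ?_⟩
  · rintro ⟨v, hv, rfl | rfl⟩ <;> simp [hv]
  · rintro (h | h)
    · exact ⟨a, h, Or.inl rfl⟩
    · exact ⟨b, h, Or.inr rfl⟩

theorem edgesMeeting_empty (H : SimpleGraph V) : edgesMeeting H ∅ = ∅ := by
  simp [edgesMeeting]

theorem edgesMeeting_mono {G H : SimpleGraph V} (h : H ≤ G) (W : Finset V) :
    edgesMeeting H W ⊆ edgesMeeting G W := by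
  intro e
  induction e using Sym2.ind with
  | _ a b => simp only [mem_edgesMeeting]; exact fun h' => ⟨h h'.1, h'.2⟩

/-- Adding a vertex `v` to `W` creates at most `deg v` new edges, and those from `v` back into `W`
are not new. -/
theorem card_edgesMeeting_insert (H : SimpleGraph V) (W : Finset V) (v : V) :
    (edgesMeeting H (insert v W)).card + (W.filter (H.Adj v)).card
      ≤ (edgesMeeting H W).card + H.degree v := by
  have hsub : edgesMeeting H (insert v W) ⊆
      edgesMeeting H W ∪ ((H.neighborFinset v) \ W).image (fun w => s(v, w)) := by
    intro e
    induction e using Sym2.ind with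
    | _ a b =>
      simp only [mem_edgesMeeting, Finset.mem_union, Finset.mem_insert, Finset.mem_image,
        Finset.mem_sdiff, mem_neighborFinset]
      rintro ⟨hab, h⟩
      by_cases hW : a ∈ W ∨ b ∈ W
      · exact Or.inl ⟨hab, hW⟩
      · push Not at hW
        right
        rcases h with (rfl | h) | (rfl | h)
        · exact ⟨b, ⟨hab, hW.2⟩, rfl⟩
        · exact absurd h hW.1
        · exact ⟨a, ⟨hab.symm, hW.1⟩, Sym2.eq_swap⟩
        · exact absurd h hW.2
  have h1 := (Finset.card_le_card hsub).trans (Finset.card_union_le _ _)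
  have h2 : (((H.neighborFinset v) \ W).image (fun w => s(v, w))).card
      ≤ ((H.neighborFinset v) \ W).card := Finset.card_image_le
  have h3 : ((H.neighborFinset v) \ W).card + (H.neighborFinset v ∩ W).card = H.degree v := by
    rw [Finset.card_sdiff_add_card_inter, card_neighborFinset_eq_degree]
  have h4 : W.filter (H.Adj v) = H.neighborFinset v ∩ W := by
    ext w; simp [and_comm]
  rw [h4]; omega

theorem card_edgesMeeting_insert_le (H : SimpleGraph V) (W : Finset V) (v : V) :
    (edgesMeeting H (insert v W)).card ≤ (edgesMeeting H W).card + H.degree v :=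
  le_trans (Nat.le_add_right _ _) (card_edgesMeeting_insert H W v)

theorem card_edgesMeeting_insert_of_adj (H : SimpleGraph V) {W : Finset V} {v w : V} (hw : w ∈ W)
    (hvw : H.Adj v w) :
    (edgesMeeting H (insert v W)).card + 1 ≤ (edgesMeeting H W).card + H.degree v := by
  have h := card_edgesMeeting_insert H W v
  have : 0 < (W.filter (H.Adj v)).card := Finset.card_pos.2 ⟨w, by simp [hw, hvw]⟩
  omega

theorem card_edgesMeeting_le_sum (H : SimpleGraph V) (W : Finset V) :
    (edgesMeeting H W).card ≤ ∑ v ∈ W, H.degree v := by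
  induction W using Finset.induction_on with
  | empty => simp [edgesMeeting_empty]
  | insert v W hv ih =>
    rw [Finset.sum_insert hv]
    have := card_edgesMeeting_insert_le H W v
    omega

theorem edgesMeeting_union (H : SimpleGraph V) (W W' : Finset V) :
    edgesMeeting H (W ∪ W') = edgesMeeting H W ∪ edgesMeeting H W' := by
  ext e
  induction e using Sym2.ind with
  | _ a b => simp only [mem_edgesMeeting, Finset.mem_union]; tauto

/-- A path on `m` vertices is met by at most `m (Δ - 1) + 1` edges. -/
theorem card_edgesMeeting_path (G : SimpleGraph V) {Δ : ℕ} (hΔ : ∀ v, G.degree v ≤ Δ)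
    (l : List V) (hl : l.IsChain G.Adj) :
    (edgesMeeting G l.toFinset).card + l.length ≤ l.length * Δ + 1 := by
  induction l with
  | nil => simp [edgesMeeting_empty]
  | cons x l ih =>
    cases l with
    | nil =>
      have := card_edgesMeeting_insert_le G ∅ x
      have h2 := hΔ x
      simp only [List.toFinset_cons, List.toFinset_nil, List.length_cons, List.length_nil,
        edgesMeeting_empty, Finset.card_empty] at this ⊢
      omega
    | cons y l =>
      rw [List.isChain_cons_cons] at hl
      have h1 := ih hl.2
      have h2 := card_edgesMeeting_insert_of_adj G (W := (y :: l).toFinset) (w := y) (by simp) hl.1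
      have h3 := hΔ x
      rw [List.toFinset_cons, List.length_cons, Nat.add_mul]
      omega

theorem edgeFinset_eq_edgesMeeting {H : SimpleGraph V} {W : Finset V}
    (h : ∀ a b, H.Adj a b → a ∈ W ∨ b ∈ W) : H.edgeFinset = edgesMeeting H W := by
  ext e
  induction e using Sym2.ind with
  | _ a b =>
    rw [mem_edgesMeeting, mem_edgeFinset, mem_edgeSet]
    exact ⟨fun h' => ⟨h', h _ _ h'⟩, fun h' => h'.1⟩

/-- The edges of a finite strong clique are those of a strong clique graph. -/
theorem exists_strongCliqueGraph {G : SimpleGraph V} (S : Finset (Sym2 V))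
    (hS : IsStrongClique G (S : Set (Sym2 V))) :
    ∃ H : SimpleGraph V, IsStrongCliqueGraph G H ∧ H.edgeFinset.card = S.card := by
  obtain ⟨H, hadj⟩ : ∃ H : SimpleGraph V, ∀ a b, H.Adj a b ↔ s(a, b) ∈ S := by
    refine ⟨fromEdgeSet (S : Set (Sym2 V)), fun a b => ?_⟩
    rw [fromEdgeSet_adj]
    refine ⟨fun h => h.1, fun h => ⟨h, ?_⟩⟩
    have : G.Adj a b := hS.1 h
    exact this.ne
  refine ⟨H, ⟨?_, ?_⟩, ?_⟩
  · intro a b h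
    exact hS.1 ((hadj a b).1 h)
  · intro a b c d hab hcd
    rw [hadj] at hab hcd
    by_cases hne : s(a, b) = s(c, d)
    · rcases Sym2.eq_iff.1 hne with ⟨rfl, -⟩ | ⟨rfl, -⟩ <;> simp
    · rcases hS.2 _ hab _ hcd hne with ⟨v, hv, hv'⟩ | ⟨x, hx, y, hy, hxy⟩
      · left
        rw [Sym2.mem_iff] at hv hv'
        rcases hv with rfl | rfl <;> rcases hv' with rfl | rfl <;> simp
      · right
        rw [Sym2.mem_iff] at hx hy
        rcases hx with rfl | rfl <;> rcases hy with rfl | rfl <;> simp [hxy]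
  · congr 1
    ext e
    induction e using Sym2.ind with
    | _ a b => rw [mem_edgeFinset, mem_edgeSet, hadj]

end Meeting

/-! ### Paths whose two end edges belong to the clique -/

/-- The list `x₁, x₂, M, u, v` is a path of `G` whose first edge `x₁x₂` and last edge `uv` are edges
of `H`. -/
structure IsCliquePath {V : Type*} (G H : SimpleGraph V) (x₁ x₂ : V) (M : List V) (u v : V) :
    Prop where
  chain : (x₁ :: x₂ :: (M ++ [u, v])).IsChain G.Adj
  nodup : (x₁ :: x₂ :: (M ++ [u, v])).Nodup
  first : H.Adj x₁ x₂
  last : H.Adj u v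

section CliquePath

variable {V : Type*} {G H : SimpleGraph V} {x₁ x₂ u v : V} {M : List V}

theorem IsCliquePath.chain_init (h : IsCliquePath G H x₁ x₂ M u v) :
    (x₁ :: x₂ :: (M ++ [u])).IsChain G.Adj := by
  have h1 := h.chain
  rw [show x₁ :: x₂ :: (M ++ [u, v]) = (x₁ :: x₂ :: (M ++ [u])) ++ [v] by simp] at h1
  exact h1.left_of_append

theorem IsCliquePath.chain_tail (h : IsCliquePath G H x₁ x₂ M u v) :
    (x₂ :: (M ++ [u, v])).IsChain G.Adj := h.chain.tail

theorem IsCliquePath.chain_inner (h : IsCliquePath G H x₁ x₂ M u v) :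
    (x₂ :: (M ++ [u])).IsChain G.Adj := h.chain_init.tail

theorem IsCliquePath.chain_snoc (h : IsCliquePath G H x₁ x₂ M u v) {w : V} (hw : G.Adj v w) :
    (x₁ :: x₂ :: (M ++ [u, v, w])).IsChain G.Adj := by
  rw [show x₁ :: x₂ :: (M ++ [u, v, w]) = (x₁ :: x₂ :: (M ++ [u, v])) ++ [w] by simp]
  refine h.chain.append (by simp) ?_
  simp [List.getLast?_cons, hw]

/-- A further clique edge at the last vertex prolongs the path by one vertex. -/
theorem IsCliquePath.snoc (hHG : H ≤ G) (h : IsCliquePath G H x₁ x₂ M u v) {w : V}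
    (hw : H.Adj v w) (hwn : w ∉ x₁ :: x₂ :: (M ++ [u, v])) :
    IsCliquePath G H x₁ x₂ (M ++ [u]) v w := by
  refine ⟨?_, ?_, h.first, hw⟩
  · simpa using h.chain_snoc (hHG hw)
  · rw [show x₁ :: x₂ :: (M ++ [u] ++ [v, w]) = (x₁ :: x₂ :: (M ++ [u, v])) ++ [w] by simp]
    exact List.Nodup.append h.nodup (by simp) (by simpa using hwn)

/-- A clique edge disjoint from the path prolongs it by one or by two vertices. -/
theorem IsCliquePath.extend (hS : IsStrongCliqueGraph G H) (h : IsCliquePath G H x₁ x₂ M u v)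
    {w z : V} (hwz : H.Adj w z) (hw : w ∉ x₁ :: x₂ :: (M ++ [u, v]))
    (hz : z ∉ x₁ :: x₂ :: (M ++ [u, v])) :
    ∃ M' u' v', IsCliquePath G H x₁ x₂ M' u' v' ∧
      (M'.length = M.length + 1 ∨ M'.length = M.length + 2) ∧
      ∀ t ∈ M' ++ [u', v'], t ∈ M ++ [u, v] ∨ t = w ∨ t = z := by
  wlog hcon : G.Adj v w ∨ G.Adj u w generalizing w z
  · refine (this hwz.symm hz hw ?_).imp fun M' => ?_
    · have := hS.adj_of_disjoint h.last hwz (a := u) (b := v) (c := w) (d := z)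
      simp only [List.mem_cons, List.mem_append, not_or] at hw hz
      have := this (Ne.symm hw.2.2.2.1) (Ne.symm hz.2.2.2.1) (Ne.symm hw.2.2.2.2.1)
        (Ne.symm hz.2.2.2.2.1)
      tauto
    · rintro ⟨u', v', h1, h2, h3⟩
      exact ⟨u', v', h1, h2, fun t ht => (h3 t ht).imp id Or.symm⟩
  have hne : w ≠ z := hwz.ne
  rcases hcon with hcon | hcon
  · refine ⟨M ++ [u, v], w, z, ⟨?_, ?_, h.first, hwz⟩, by simp, ?_⟩
    · rw [show x₁ :: x₂ :: (M ++ [u, v] ++ [w, z]) = (x₁ :: x₂ :: (M ++ [u, v])) ++ [w, z] by simp]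
      refine h.chain.append (by simpa using hS.1 hwz) ?_
      simp [List.getLast?_cons, hcon]
    · rw [show x₁ :: x₂ :: (M ++ [u, v] ++ [w, z]) = (x₁ :: x₂ :: (M ++ [u, v])) ++ [w, z] by simp]
      refine List.Nodup.append h.nodup (by simpa using hne) ?_
      simp only [List.disjoint_cons_right, hw, hz, not_false_eq_true, List.disjoint_nil_right,
        and_self]
    · simp; tauto
  · refine ⟨M ++ [u], w, z, ⟨?_, ?_, h.first, hwz⟩, by simp, ?_⟩
    · rw [show x₁ :: x₂ :: (M ++ [u] ++ [w, z]) = (x₁ :: x₂ :: (M ++ [u])) ++ [w, z] by simp]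
      refine h.chain_init.append (by simpa using hS.1 hwz) ?_
      simp [List.getLast?_cons, hcon]
    · have h1 := h.nodup
      rw [show x₁ :: x₂ :: (M ++ [u, v]) = (x₁ :: x₂ :: (M ++ [u])) ++ [v] by simp] at h1 hw hz
      rw [show x₁ :: x₂ :: (M ++ [u] ++ [w, z]) = (x₁ :: x₂ :: (M ++ [u])) ++ [w, z] by simp]
      rw [List.mem_append, not_or] at hw hz
      refine List.Nodup.append h1.of_append_left (by simpa using hne) ?_
      simp only [List.disjoint_cons_right, hw.1, hz.1, not_false_eq_true, List.disjoint_nil_right,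
        and_self]
    · simp; tauto

/-- Two disjoint clique edges form, after orienting them suitably, a path on four vertices. -/
theorem exists_isCliquePath_nil (hS : IsStrongCliqueGraph G H) {a b w z : V} (hab : H.Adj a b)
    (hwz : H.Adj w z) (haw : a ≠ w) (haz : a ≠ z) (hbw : b ≠ w) (hbz : b ≠ z) :
    ∃ x₁ x₂ u v, IsCliquePath G H x₁ x₂ [] u v ∧ (x₁ = a ∧ x₂ = b ∨ x₁ = b ∧ x₂ = a) ∧
      (u = w ∧ v = z ∨ u = z ∧ v = w) := by
  have key : ∀ {a b w z : V}, H.Adj a b → H.Adj w z → a ≠ w → a ≠ z → b ≠ w → b ≠ z →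
      G.Adj b w → IsCliquePath G H a b [] w z := by
    intro a b w z hab hwz haw haz hbw hbz hbw'
    refine ⟨?_, ?_, hab, hwz⟩
    · simp [hS.1 hab, hS.1 hwz, hbw']
    · simp [hab.ne, hwz.ne, *]
  rcases hS.adj_of_disjoint hab hwz haw haz hbw hbz with h | h | h | h
  · exact ⟨b, a, w, z, key hab.symm hwz hbw hbz haw haz h, by simp, by simp⟩
  · exact ⟨b, a, z, w, key hab.symm hwz.symm hbz hbw haz haw h, by simp, by simp⟩
  · exact ⟨a, b, w, z, key hab hwz haw haz hbw hbz h, by simp, by simp⟩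
  · exact ⟨a, b, z, w, key hab hwz.symm haz haw hbz hbw h, by simp, by simp⟩

/-! ### Three consecutive forbidden cycle lengths -/

/-- With the cycle lengths `2k`, `2k + 1`, `2k + 2` forbidden, no closed list of distinct vertices
has one of these lengths. -/
theorem not_closed_of_free {k : ℕ} (hk : 2 ≤ k)
    (hC : ∀ n, 2 * k ≤ n → n ≤ 2 * k + 2 → (cycleGraph n).Free G) {a b : V} {l : List V}
    (hchain : (a :: l).IsChain G.Adj) (hnodup : (a :: l).Nodup)
    (hlast : (a :: l).getLast? = some b) (hba : G.Adj b a) (h1 : 2 * k ≤ l.length + 1)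
    (h2 : l.length ≤ 2 * k + 1) : False :=
  hC (a :: l).length (by simpa using h1) (by simpa using h2)
    (cycleGraph_isContained_of_list hchain hnodup hlast hba (by simp; omega))

/-- The end edges of a path on `2k + 2` vertices would close a cycle of length `2k`, `2k + 1` or
`2k + 2`. -/
theorem IsCliquePath.length_ne {k : ℕ} (hk : 2 ≤ k)
    (hC : ∀ n, 2 * k ≤ n → n ≤ 2 * k + 2 → (cycleGraph n).Free G)
    (hS : IsStrongCliqueGraph G H) (h : IsCliquePath G H x₁ x₂ M u v) :
    M.length + 4 ≠ 2 * k + 2 := by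
  intro hlen
  have hn := h.nodup
  have c0 := h.chain
  have c1 := h.chain_tail
  have c2 := h.chain_init
  have c3 := h.chain_inner
  have hadj : G.Adj x₁ u ∨ G.Adj x₁ v ∨ G.Adj x₂ u ∨ G.Adj x₂ v := by
    refine hS.adj_of_disjoint h.first h.last ?_ ?_ ?_ ?_ <;>
    · rintro rfl; simp at hn
  rcases hadj with h' | h' | h' | h'
  · exact not_closed_of_free hk hC c2 (by grind) (by simp [List.getLast?_cons]) h'.symm
      (by simp; omega) (by simp; omega)
  · exact not_closed_of_free hk hC c0 hn (by simp [List.getLast?_cons]) h'.symm (by simp; omega)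
      (by simp; omega)
  · exact not_closed_of_free hk hC c3 (by grind) (by simp [List.getLast?_cons]) h'.symm
      (by simp; omega) (by simp; omega)
  · exact not_closed_of_free hk hC c1 (by grind) (by simp [List.getLast?_cons]) h'.symm
      (by simp; omega) (by simp; omega)

end CliquePath

/-- A path `x₁, x₂, M, u, v` with clique edges at both ends, together with a disjoint path
`y, c, c', z` whose ends are joined to `x₁` and `x₂`, where `yc` and `c'z` are clique edges: the
clique edges `x₁x₂`, `yc`, `c'z` alternate around the hexagon `x₁, y, c, c', z, x₂`. -/
structure IsHexagonPath {V : Type*} (G H : SimpleGraph V) (y c c' z x₁ x₂ : V) (M : List V)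
    (u v : V) : Prop where
  path : IsCliquePath G H x₁ x₂ M u v
  adj_left : G.Adj x₁ y
  adj_yc : H.Adj y c
  adj_cc : G.Adj c c'
  adj_cz : H.Adj c' z
  adj_right : G.Adj z x₂
  nodup : (z :: c' :: c :: y :: x₁ :: x₂ :: (M ++ [u, v])).Nodup

section Hexagon

variable {V : Type*} {G H : SimpleGraph V} {y c c' z x₁ x₂ u v : V} {M : List V} {k : ℕ}

theorem IsHexagonPath.nodup_init (h : IsHexagonPath G H y c c' z x₁ x₂ M u v) :
    (z :: c' :: c :: y :: x₁ :: x₂ :: (M ++ [u])).Nodup := by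
  have hn := h.nodup
  rw [show z :: c' :: c :: y :: x₁ :: x₂ :: (M ++ [u, v]) =
    (z :: c' :: c :: y :: x₁ :: x₂ :: (M ++ [u])) ++ [v] by simp] at hn
  exact hn.of_append_left

/-- Each adjacency between the last clique edge `uv` of a hexagon path and the hexagon closes a
cycle through the path and part of the hexagon. It is excluded if the length of that cycle, which is
the number in the clause, lies between `2k` and `2k + 2`. The vertices `y` and `v` are joined by two
such detours. -/
theorem IsHexagonPath.not_adj (hk : 2 ≤ k)
    (hC : ∀ n, 2 * k ≤ n → n ≤ 2 * k + 2 → (cycleGraph n).Free G)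
    (hS : IsStrongCliqueGraph G H) (h : IsHexagonPath G H y c c' z x₁ x₂ M u v) :
    (G.Adj z v → 2 * k ≤ M.length + 8 → ¬ M.length + 8 ≤ 2 * k + 2) ∧
    (G.Adj z u → 2 * k ≤ M.length + 7 → ¬ M.length + 7 ≤ 2 * k + 2) ∧
    (G.Adj c' v → 2 * k ≤ M.length + 7 → ¬ M.length + 7 ≤ 2 * k + 2) ∧
    (G.Adj c' u → 2 * k ≤ M.length + 6 → ¬ M.length + 6 ≤ 2 * k + 2) ∧
    (G.Adj y v → 2 * k ≤ M.length + 7 → ¬ M.length + 7 ≤ 2 * k + 2) ∧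
    (G.Adj y v → 2 * k ≤ M.length + 5 → ¬ M.length + 5 ≤ 2 * k + 2) ∧
    (G.Adj y u → 2 * k ≤ M.length + 6 → ¬ M.length + 6 ≤ 2 * k + 2) ∧
    (G.Adj c v → 2 * k ≤ M.length + 6 → ¬ M.length + 6 ≤ 2 * k + 2) ∧
    (G.Adj c u → 2 * k ≤ M.length + 5 → ¬ M.length + 5 ≤ 2 * k + 2) := by
  have hn := h.nodup
  have hn' := h.nodup_init
  have a1 := h.adj_left.symm
  have a2 := hS.1 h.adj_yc
  have a3 := h.adj_cc
  have a4 := hS.1 h.adj_cz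
  have a5 := h.adj_right
  have c0 := h.path.chain
  have c1 := h.path.chain_tail
  have c2 := h.path.chain_init
  have c3 := h.path.chain_inner
  refine ⟨?_, ?_, ?_, ?_, ?_, ?_, ?_, ?_, ?_⟩
  · intro h' h1 h2
    refine not_closed_of_free hk hC (a := z) (b := v)
      (l := c' :: c :: y :: x₁ :: x₂ :: (M ++ [u, v])) ?_ hn (by simp [List.getLast?_cons]) h'.symm
      (by simp; omega) (by simp; omega)
    simp only [List.isChain_cons_cons] at c0 ⊢
    exact ⟨a4.symm, a3.symm, a2.symm, a1, c0⟩
  · intro h' h1 h2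
    refine not_closed_of_free hk hC (a := z) (b := u)
      (l := c' :: c :: y :: x₁ :: x₂ :: (M ++ [u])) ?_
      (by grind only [List.nodup_cons, List.mem_cons]) (by simp [List.getLast?_cons])
      h'.symm (by simp; omega) (by simp; omega)
    simp only [List.isChain_cons_cons] at c2 ⊢
    exact ⟨a4.symm, a3.symm, a2.symm, a1, c2⟩
  · intro h' h1 h2
    refine not_closed_of_free hk hC (a := c') (b := v)
      (l := c :: y :: x₁ :: x₂ :: (M ++ [u, v])) ?_ (by grind only [List.nodup_cons, List.mem_cons])
      (by simp [List.getLast?_cons])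
      h'.symm (by simp; omega) (by simp; omega)
    simp only [List.isChain_cons_cons] at c0 ⊢
    exact ⟨a3.symm, a2.symm, a1, c0⟩
  · intro h' h1 h2
    refine not_closed_of_free hk hC (a := c') (b := u)
      (l := c :: y :: x₁ :: x₂ :: (M ++ [u])) ?_ (by grind only [List.nodup_cons, List.mem_cons])
      (by simp [List.getLast?_cons])
      h'.symm (by simp; omega) (by simp; omega)
    simp only [List.isChain_cons_cons] at c2 ⊢
    exact ⟨a3.symm, a2.symm, a1, c2⟩
  · intro h' h1 h2
    refine not_closed_of_free hk hC (a := y) (b := v)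
      (l := c :: c' :: z :: x₂ :: (M ++ [u, v])) ?_ (by grind only [List.nodup_cons, List.mem_cons])
      (by simp [List.getLast?_cons])
      h'.symm (by simp; omega) (by simp; omega)
    simp only [List.isChain_cons_cons]
    exact ⟨a2, a3, a4, a5, c1⟩
  · intro h' h1 h2
    refine not_closed_of_free hk hC (a := y) (b := v)
      (l := x₁ :: x₂ :: (M ++ [u, v])) ?_ (by grind only [List.nodup_cons, List.mem_cons])
      (by simp [List.getLast?_cons])
      h'.symm (by simp; omega) (by simp; omega)
    simp only [List.isChain_cons_cons] at c0 ⊢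
    exact ⟨a1, c0⟩
  · intro h' h1 h2
    refine not_closed_of_free hk hC (a := y) (b := u)
      (l := c :: c' :: z :: x₂ :: (M ++ [u])) ?_ (by grind only [List.nodup_cons, List.mem_cons])
      (by simp [List.getLast?_cons])
      h'.symm (by simp; omega) (by simp; omega)
    simp only [List.isChain_cons_cons]
    exact ⟨a2, a3, a4, a5, c3⟩
  · intro h' h1 h2
    refine not_closed_of_free hk hC (a := c) (b := v)
      (l := y :: x₁ :: x₂ :: (M ++ [u, v])) ?_ (by grind only [List.nodup_cons, List.mem_cons])
      (by simp [List.getLast?_cons])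
      h'.symm (by simp; omega) (by simp; omega)
    simp only [List.isChain_cons_cons] at c0 ⊢
    exact ⟨a2.symm, a1, c0⟩
  · intro h' h1 h2
    refine not_closed_of_free hk hC (a := c) (b := u)
      (l := y :: x₁ :: x₂ :: (M ++ [u])) ?_ (by grind only [List.nodup_cons, List.mem_cons])
      (by simp [List.getLast?_cons])
      h'.symm (by simp; omega) (by simp; omega)
    simp only [List.isChain_cons_cons] at c2 ⊢
    exact ⟨a2.symm, a1, c2⟩

theorem IsHexagonPath.adj_cz_last (hS : IsStrongCliqueGraph G H)
    (h : IsHexagonPath G H y c c' z x₁ x₂ M u v) :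
    G.Adj z u ∨ G.Adj z v ∨ G.Adj c' u ∨ G.Adj c' v := by
  have hn := h.nodup
  refine hS.adj_of_disjoint h.adj_cz.symm h.path.last ?_ ?_ ?_ ?_ <;>
  · rintro rfl; simp at hn

theorem IsHexagonPath.adj_yc_last (hS : IsStrongCliqueGraph G H)
    (h : IsHexagonPath G H y c c' z x₁ x₂ M u v) :
    G.Adj y u ∨ G.Adj y v ∨ G.Adj c u ∨ G.Adj c v := by
  have hn := h.nodup
  refine hS.adj_of_disjoint h.adj_yc h.path.last ?_ ?_ ?_ ?_ <;>
  · rintro rfl; simp at hn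

/-- The path of a hexagon path never has `2k - 2` or `2k - 1` vertices. -/
theorem IsHexagonPath.length_ne (hk : 2 ≤ k)
    (hC : ∀ n, 2 * k ≤ n → n ≤ 2 * k + 2 → (cycleGraph n).Free G)
    (hS : IsStrongCliqueGraph G H) (h : IsHexagonPath G H y c c' z x₁ x₂ M u v) :
    M.length + 6 ≠ 2 * k ∧ M.length + 5 ≠ 2 * k := by
  obtain ⟨h1, h2, h3, h4, h5, h6, h7, h8, h9⟩ := h.not_adj hk hC hS
  refine ⟨fun hlen => ?_, fun hlen => ?_⟩
  · rcases h.adj_cz_last hS with h' | h' | h' | h'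
    · exact h2 h' (by omega) (by omega)
    · exact h1 h' (by omega) (by omega)
    · exact h4 h' (by omega) (by omega)
    · exact h3 h' (by omega) (by omega)
  · rcases h.adj_yc_last hS with h' | h' | h' | h'
    · exact h7 h' (by omega) (by omega)
    · exact h6 h' (by omega) (by omega)
    · exact h9 h' (by omega) (by omega)
    · exact h8 h' (by omega) (by omega)

/-- A clique edge disjoint from a hexagon path prolongs it by one or two vertices. -/
theorem IsHexagonPath.extend (hS : IsStrongCliqueGraph G H)
    (h : IsHexagonPath G H y c c' z x₁ x₂ M u v) {w t : V} (hwt : H.Adj w t)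
    (hw : w ∉ z :: c' :: c :: y :: x₁ :: x₂ :: (M ++ [u, v]))
    (ht : t ∉ z :: c' :: c :: y :: x₁ :: x₂ :: (M ++ [u, v])) :
    ∃ M' u' v', IsHexagonPath G H y c c' z x₁ x₂ M' u' v' ∧
      (M'.length = M.length + 1 ∨ M'.length = M.length + 2) := by
  have hn := h.nodup
  obtain ⟨M', u', v', h1, h2, h3⟩ := h.path.extend hS hwt
    (by grind only [List.nodup_cons, List.mem_cons])
    (by grind only [List.nodup_cons, List.mem_cons])
  refine ⟨M', u', v', ⟨h1, h.adj_left, h.adj_yc, h.adj_cc, h.adj_cz, h.adj_right, ?_⟩, h2⟩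
  have hn' := h1.nodup
  have key : ∀ s ∈ [z, c', c, y], s ∉ M' ++ [u', v'] := by
    intro s hs hs'
    rcases h3 s hs' with h4 | rfl | rfl <;>
      grind only [List.nodup_cons, List.mem_cons, List.mem_append, List.not_mem_nil]
  simp only [List.mem_cons, List.not_mem_nil, or_false, forall_eq_or_imp, forall_eq] at key
  rw [List.nodup_cons, List.nodup_cons, List.nodup_cons, List.nodup_cons] at hn ⊢
  simp only [List.mem_cons, not_or] at hn ⊢
  tauto

/-- A further clique edge at the last vertex prolongs a hexagon path by one vertex. -/
theorem IsHexagonPath.snoc (hS : IsStrongCliqueGraph G H)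
    (h : IsHexagonPath G H y c c' z x₁ x₂ M u v) {w : V} (hvw : H.Adj v w)
    (hw : w ∉ z :: c' :: c :: y :: x₁ :: x₂ :: (M ++ [u, v])) :
    IsHexagonPath G H y c c' z x₁ x₂ (M ++ [u]) v w := by
  have hn := h.nodup
  refine ⟨h.path.snoc hS.1 hvw (by grind only [List.nodup_cons, List.mem_cons]),
    h.adj_left, h.adj_yc, h.adj_cc, h.adj_cz, h.adj_right,
    ?_⟩
  rw [show z :: c' :: c :: y :: x₁ :: x₂ :: (M ++ [u] ++ [v, w]) =
    (z :: c' :: c :: y :: x₁ :: x₂ :: (M ++ [u, v])) ++ [w] by simp]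
  exact List.Nodup.append hn (by simp) (by simpa using hw)

/-- A longest hexagon path on at most `2k - 3` vertices provides a path on at most `2k - 1` vertices
meeting every clique edge: the last vertex may be dropped, and in the extremal case also one vertex
of the hexagon. -/
theorem IsHexagonPath.exists_path_meeting (hk : 4 ≤ k)
    (hC : ∀ n, 2 * k ≤ n → n ≤ 2 * k + 2 → (cycleGraph n).Free G)
    (hS : IsStrongCliqueGraph G H) (h : IsHexagonPath G H y c c' z x₁ x₂ M u v)
    (hm : M.length ≤ 2 * k - 7)
    (hmax : ∀ {M' u' v'}, IsHexagonPath G H y c c' z x₁ x₂ M' u' v' →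
      M'.length ≤ 2 * k - 7 → M'.length ≤ M.length) :
    ∃ l : List V, l.IsChain G.Adj ∧ l.length ≤ 2 * k - 1 ∧
      ∀ p q, H.Adj p q → p ∈ l ∨ q ∈ l := by
  have hnodup := h.nodup
  have hninit := h.nodup_init
  have hmem : ∀ w, w ∈ z :: c' :: c :: y :: x₁ :: x₂ :: (M ++ [u, v]) ↔
      w ∈ z :: c' :: c :: y :: x₁ :: x₂ :: (M ++ [u]) ∨ w = v := by
    intro w
    simp only [List.mem_cons, List.mem_append, List.not_mem_nil]
    tauto
  have hcov : ∀ p q, H.Adj p q → p ∈ z :: c' :: c :: y :: x₁ :: x₂ :: (M ++ [u, v]) ∨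
      q ∈ z :: c' :: c :: y :: x₁ :: x₂ :: (M ++ [u, v]) := by
    intro p q hpq
    by_contra! hcon
    obtain ⟨M', u', v', h1, h2⟩ := h.extend hS hpq hcon.1 hcon.2
    have h3 := h1.length_ne (by omega) hC hS
    have h4 := hmax h1
    omega
  have hsnoc : ∀ w, H.Adj v w → w ∈ z :: c' :: c :: y :: x₁ :: x₂ :: (M ++ [u]) := by
    intro w hvw
    by_contra hcon
    have hwv : w ≠ v := hvw.ne'
    have h1 := h.snoc hS hvw fun hc => ((hmem w).1 hc).elim hcon hwv
    have h3 := h1.length_ne (by omega) hC hS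
    have h4 := hmax h1
    simp only [List.length_append, List.length_cons, List.length_nil] at h3 h4
    omega
  have c0 := h.path.chain
  have c2 := h.path.chain_init
  have chain0 : (c' :: c :: y :: x₁ :: x₂ :: (M ++ [u])).IsChain G.Adj := by
    simp only [List.isChain_cons_cons] at c2 ⊢
    exact ⟨h.adj_cc.symm, (hS.1 h.adj_yc).symm, h.adj_left.symm, c2⟩
  have chain1 : (z :: c' :: c :: y :: x₁ :: x₂ :: (M ++ [u])).IsChain G.Adj := by
    simp only [List.isChain_cons_cons] at chain0 ⊢
    exact ⟨(hS.1 h.adj_cz).symm, chain0⟩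
  -- all clique edges at `v` run into the rest of the hexagon path, so `v` may be dropped
  have hcov' : ∀ p q, H.Adj p q → p ∈ z :: c' :: c :: y :: x₁ :: x₂ :: (M ++ [u]) ∨
      q ∈ z :: c' :: c :: y :: x₁ :: x₂ :: (M ++ [u]) := by
    intro p q hpq
    by_cases hpv : p = v
    · subst hpv; exact Or.inr (hsnoc q hpq)
    by_cases hqv : q = v
    · subst hqv; exact Or.inl (hsnoc p hpq.symm)
    exact (hcov p q hpq).imp (fun h' => ((hmem p).1 h').resolve_right hpv)
      fun h' => ((hmem q).1 h').resolve_right hqv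
  rcases Nat.lt_or_ge M.length (2 * k - 7) with hlt | hge
  · refine ⟨_, chain1, ?_, hcov'⟩
    simp; omega
  -- the path has exactly `2k - 3` vertices, and `z` is dropped as well
  obtain ⟨h1, h2, h3, h4, h5, h6, h7, h8, h9⟩ := h.not_adj (by omega) hC hS
  have hzu : ¬ G.Adj z u := fun h' => h2 h' (by omega) (by omega)
  have hzv : ¬ G.Adj z v := fun h' => h1 h' (by omega) (by omega)
  have hz : ∀ w, H.Adj z w → w ∈ c' :: c :: y :: x₁ :: x₂ :: (M ++ [u]) := by
    intro w hzw
    by_contra hcon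
    have hwz : w ≠ z := hzw.ne'
    have hwv : w ≠ v := by rintro rfl; exact hzv (hS.1 hzw)
    have hwn' : w ∉ z :: c' :: c :: y :: x₁ :: x₂ :: (M ++ [u]) :=
      fun hc => (List.mem_cons.1 hc).elim hwz hcon
    have hwn : (w :: z :: c' :: c :: y :: x₁ :: x₂ :: (M ++ [u, v])).Nodup :=
      List.nodup_cons.2 ⟨fun hc => ((hmem w).1 hc).elim hwn' hwv, hnodup⟩
    have hadj : G.Adj z u ∨ G.Adj z v ∨ G.Adj w u ∨ G.Adj w v := by
      refine hS.adj_of_disjoint hzw h.path.last ?_ ?_ ?_ ?_ <;>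
      · rintro rfl; simp at hwn
    rcases hadj with h' | h' | h' | h'
    · exact hzu h'
    · exact hzv h'
    · refine not_closed_of_free (by omega) hC (a := w) (b := u)
        (l := z :: c' :: c :: y :: x₁ :: x₂ :: (M ++ [u])) ?_ (List.nodup_cons.2 ⟨hwn', hninit⟩)
        (by simp [List.getLast?_cons]) h'.symm (by simp; omega) (by simp; omega)
      rw [List.isChain_cons_cons]
      exact ⟨(hS.1 hzw).symm, chain1⟩
    · refine not_closed_of_free (by omega) hC (a := w) (b := v)
        (l := z :: c' :: c :: y :: x₁ :: x₂ :: (M ++ [u, v])) ?_ hwn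
        (by simp [List.getLast?_cons]) h'.symm (by simp; omega) (by simp; omega)
      simp only [List.isChain_cons_cons] at c0 chain1 ⊢
      exact ⟨(hS.1 hzw).symm, chain1.1, chain1.2.1, chain1.2.2.1, chain1.2.2.2.1, c0⟩
  refine ⟨_, chain0, ?_, ?_⟩
  · simp; omega
  · intro p q hpq
    by_cases hpz : p = z
    · subst hpz; exact Or.inr (hz q hpq)
    by_cases hqz : q = z
    · subst hqz; exact Or.inl (hz p hpq.symm)
    exact (hcov' p q hpq).imp (fun h' => (List.mem_cons.1 h').resolve_left hpz)
      fun h' => (List.mem_cons.1 h').resolve_left hqz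

theorem exists_maximal_le {P : ℕ → Prop} {N n : ℕ} (hn : n ≤ N) (hP : P n) :
    ∃ m ≤ N, P m ∧ ∀ i ≤ N, P i → i ≤ m := by
  classical
  exact ⟨Nat.findGreatest P N, Nat.findGreatest_le N, Nat.findGreatest_spec hn hP,
    fun i hi hPi => Nat.le_findGreatest hi hPi⟩

/-- If three clique edges alternate around a hexagon, then a path of `G` on at most `2k - 1`
vertices meets every clique edge. -/
theorem exists_path_meeting_of_hexagon (hk : 4 ≤ k)
    (hC : ∀ n, 2 * k ≤ n → n ≤ 2 * k + 2 → (cycleGraph n).Free G)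
    (hS : IsStrongCliqueGraph G H) {a b : V} (hab : H.Adj a b) (hya : G.Adj a y)
    (hyc : H.Adj y c) (hcc : G.Adj c c') (hcz : H.Adj c' z) (hzb : G.Adj z b)
    (hnodup : [z, c', c, y, a, b].Nodup) :
    ∃ l : List V, l.IsChain G.Adj ∧ l.length ≤ 2 * k - 1 ∧ ∀ p q, H.Adj p q → p ∈ l ∨ q ∈ l := by
  by_cases hcover : ∀ p q, H.Adj p q → p ∈ [z, c', c, y, a, b] ∨ q ∈ [z, c', c, y, a, b]
  · refine ⟨_, ?_, ?_, hcover⟩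
    · simp [(hS.1 hcz).symm, hcc.symm, (hS.1 hyc).symm, hya.symm, hS.1 hab]
    · simp; omega
  push Not at hcover
  obtain ⟨p, q, hpq, hp, hq⟩ := hcover
  -- a first hexagon path, with a path on four vertices
  have hstart : ∃ n, n ≤ 2 * k - 7 ∧ ∃ y c c' z x₁ x₂ M u v,
      IsHexagonPath G H y c c' z x₁ x₂ M u v ∧ M.length = n := by
    simp only [List.mem_cons, List.not_mem_nil, or_false, not_or] at hp hq
    obtain ⟨x₁, x₂, u, v, hpath, hx, huv⟩ := exists_isCliquePath_nil hS hab hpq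
      (Ne.symm hp.2.2.2.2.1) (Ne.symm hq.2.2.2.2.1) (Ne.symm hp.2.2.2.2.2) (Ne.symm hq.2.2.2.2.2)
    have hpn := hpath.nodup
    refine ⟨0, by omega, ?_⟩
    rcases hx with ⟨rfl, rfl⟩ | ⟨rfl, rfl⟩
    · refine ⟨y, c, c', z, _, _, [], u, v, ⟨hpath, hya, hyc, hcc, hcz, hzb, ?_⟩, rfl⟩
      rcases huv with ⟨rfl, rfl⟩ | ⟨rfl, rfl⟩ <;>
      grind only [List.nodup_cons, List.mem_cons, List.not_mem_nil, List.nodup_nil,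
        List.nil_append]
    · refine ⟨z, c', c, y, _, _, [], u, v,
        ⟨hpath, hzb.symm, hcz.symm, hcc.symm, hyc.symm, hya.symm, ?_⟩, rfl⟩
      rcases huv with ⟨rfl, rfl⟩ | ⟨rfl, rfl⟩ <;>
      grind only [List.nodup_cons, List.mem_cons, List.not_mem_nil, List.nodup_nil,
        List.nil_append]
  obtain ⟨n, hn, hP⟩ := hstart
  obtain ⟨m, hm, ⟨y, c, c', z, x₁, x₂, M, u, v, h, hlen⟩, hmax⟩ := exists_maximal_le
    (P := fun n => ∃ y c c' z x₁ x₂ M u v,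
      IsHexagonPath G H y c c' z x₁ x₂ M u v ∧ M.length = n) hn hP
  subst hlen
  exact h.exists_path_meeting hk hC hS hm fun h' hle => hmax _ hle
    ⟨_, _, _, _, _, _, _, _, _, h', rfl⟩

end Hexagon

section CliquePath

variable {V : Type*} {G H : SimpleGraph V} {x₁ x₂ u v : V} {M : List V} {k : ℕ}

/-- A further clique edge at the first vertex prolongs the path by one vertex. -/
theorem IsCliquePath.cons (hHG : H ≤ G) (h : IsCliquePath G H x₁ x₂ M u v) {w : V}
    (hw : H.Adj x₁ w) (hwn : w ∉ x₁ :: x₂ :: (M ++ [u, v])) :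
    IsCliquePath G H w x₁ (x₂ :: M) u v :=
  ⟨List.isChain_cons_cons.2 ⟨(hHG hw).symm, h.chain⟩, List.nodup_cons.2 ⟨hwn, h.nodup⟩, hw.symm,
    h.last⟩

theorem IsCliquePath.nodup_init (h : IsCliquePath G H x₁ x₂ M u v) :
    (x₁ :: x₂ :: (M ++ [u])).Nodup := by
  have hn := h.nodup
  rw [show x₁ :: x₂ :: (M ++ [u, v]) = (x₁ :: x₂ :: (M ++ [u])) ++ [v] by simp] at hn
  exact hn.of_append_left

theorem IsCliquePath.mem_iff {w : V} : w ∈ x₁ :: x₂ :: (M ++ [u, v]) ↔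
    w ∈ x₂ :: (M ++ [u]) ∨ w = x₁ ∨ w = v := by
  simp only [List.mem_cons, List.mem_append, List.not_mem_nil]
  tauto

/-- If no clique edge leaves the path at one of its two ends and none joins the two ends, then the
inner vertices already meet every clique edge that meets the path. -/
theorem IsCliquePath.inner_meeting (h : IsCliquePath G H x₁ x₂ M u v) (hends : ¬ H.Adj x₁ v)
    (hfirst : ∀ w, H.Adj x₁ w → w ∈ x₁ :: x₂ :: (M ++ [u, v]))
    (hlast : ∀ w, H.Adj v w → w ∈ x₁ :: x₂ :: (M ++ [u, v])) {p q : V} (hpq : H.Adj p q)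
    (hmem : p ∈ x₁ :: x₂ :: (M ++ [u, v]) ∨ q ∈ x₁ :: x₂ :: (M ++ [u, v])) :
    p ∈ x₂ :: (M ++ [u]) ∨ q ∈ x₂ :: (M ++ [u]) := by
  wlog hp : p ∈ x₁ :: x₂ :: (M ++ [u, v]) generalizing p q
  · exact (this hpq.symm hmem.symm (hmem.resolve_left hp)).symm
  rcases mem_iff.1 hp with hp | rfl | rfl
  · exact Or.inl hp
  · rcases mem_iff.1 (hfirst q hpq) with hq | rfl | rfl
    · exact Or.inr hq
    · exact absurd hpq H.irrefl
    · exact absurd hpq hends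
  · rcases mem_iff.1 (hlast q hpq) with hq | rfl | rfl
    · exact Or.inr hq
    · exact absurd hpq.symm hends
    · exact absurd hpq H.irrefl

/-- A clique edge missed by a path on `2k + 1` vertices spans a hexagon with the two end edges of
the path. -/
theorem IsCliquePath.exists_path_meeting_of_missed (hk : 2 ≤ k)
    (hC : ∀ n, 2 * k ≤ n → n ≤ 2 * k + 2 → (cycleGraph n).Free G)
    (hS : IsStrongCliqueGraph G H) (h : IsCliquePath G H x₁ x₂ M u v)
    (hm : M.length = 2 * k - 3) {a b : V} (hab : H.Adj a b)
    (ha : a ∉ x₁ :: x₂ :: (M ++ [u, v])) (hb : b ∉ x₁ :: x₂ :: (M ++ [u, v])) :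
    ∃ l : List V, l.IsChain G.Adj ∧ l.length ≤ 2 * k - 1 ∧ ∀ p q, H.Adj p q → p ∈ l ∨ q ∈ l := by
  have hnodup := h.nodup
  have hninit := h.nodup_init
  have c0 := h.chain
  have c1 := h.chain_tail
  have c2 := h.chain_init
  have hadj2 : G.Adj x₂ u := by
    have hadj : G.Adj x₁ u ∨ G.Adj x₁ v ∨ G.Adj x₂ u ∨ G.Adj x₂ v := by
      refine hS.adj_of_disjoint h.first h.last ?_ ?_ ?_ ?_ <;>
      · rintro rfl; simp at hnodup
    rcases hadj with h' | h' | h' | h'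
    · exact (not_closed_of_free hk hC c2 hninit (by simp [List.getLast?_cons]) h'.symm
        (by simp; omega) (by simp; omega)).elim
    · exact (not_closed_of_free hk hC c0 hnodup (by simp [List.getLast?_cons]) h'.symm
        (by simp; omega) (by simp; omega)).elim
    · exact h'
    · exact (not_closed_of_free hk hC c1 hnodup.of_cons (by simp [List.getLast?_cons]) h'.symm
        (by simp; omega) (by simp; omega)).elim
  have hsix : [x₁, x₂, u, v].Nodup := by
    have h1 : [x₁, x₂, u, v].Sublist (x₁ :: x₂ :: (M ++ [u, v])) := by simp
    exact hnodup.sublist h1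
  have hav : a ∉ [x₁, x₂, u, v] := fun h' => ha (by simp at h' ⊢; tauto)
  have hbv : b ∉ [x₁, x₂, u, v] := fun h' => hb (by simp at h' ⊢; tauto)
  have hnear : ∀ {a b}, H.Adj a b → a ∉ x₁ :: x₂ :: (M ++ [u, v]) →
      b ∉ x₁ :: x₂ :: (M ++ [u, v]) → ¬ G.Adj u a ∧ ¬ G.Adj x₂ a ∧ ¬ (G.Adj x₁ a ∧ G.Adj v a) := by
    intro a b hab ha hb
    have hab' : a ≠ b := hab.ne
    refine ⟨fun h' => ?_, fun h' => ?_, fun h' => ?_⟩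
    · have hp : IsCliquePath G H x₁ x₂ (M ++ [u]) a b := by
        refine ⟨?_, ?_, h.first, hab⟩
        · rw [show x₁ :: x₂ :: (M ++ [u] ++ [a, b]) = (x₁ :: x₂ :: (M ++ [u])) ++ [a, b] by simp]
          refine c2.append (by simpa using hS.1 hab) ?_
          simp [List.getLast?_cons, h']
        · rw [show x₁ :: x₂ :: (M ++ [u] ++ [a, b]) = (x₁ :: x₂ :: (M ++ [u])) ++ [a, b] by simp]
          have ha' : a ∉ x₁ :: x₂ :: (M ++ [u]) := fun hc => ha (by simp at hc ⊢; tauto)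
          have hb' : b ∉ x₁ :: x₂ :: (M ++ [u]) := fun hc => hb (by simp at hc ⊢; tauto)
          refine List.Nodup.append hninit (by simpa using hab') ?_
          simp only [List.disjoint_cons_right, ha', hb', not_false_eq_true,
            List.disjoint_nil_right, and_self]
      refine hp.length_ne hk hC hS ?_
      simp; omega
    · have hp : IsCliquePath G H b a (x₂ :: M) u v := by
        refine ⟨?_, ?_, hab.symm, h.last⟩
        · exact List.isChain_cons_cons.2 ⟨(hS.1 hab).symm, List.isChain_cons_cons.2 ⟨h'.symm, c1⟩⟩
        · refine List.nodup_cons.2 ⟨fun hc => ?_, List.nodup_cons.2 ⟨fun hc => ?_, hnodup.of_cons⟩⟩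
          · exact (List.mem_cons.1 hc).elim hab'.symm fun hc => hb (List.mem_cons_of_mem _ hc)
          · exact ha (List.mem_cons_of_mem _ hc)
      refine hp.length_ne hk hC hS ?_
      simp; omega
    · refine not_closed_of_free hk hC (a := a) (b := v) (l := x₁ :: x₂ :: (M ++ [u, v]))
        (List.isChain_cons_cons.2 ⟨h'.1.symm, c0⟩) (List.nodup_cons.2 ⟨ha, hnodup⟩)
        (by simp [List.getLast?_cons]) h'.2 (by simp; omega) (by simp; omega)
  have hna := hnear hab ha hb
  have hnb := hnear hab.symm hb ha
  simp only [List.mem_cons, List.not_mem_nil, or_false, not_or] at hav hbv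
  have hvab := hS.adj_of_disjoint h.last hab (Ne.symm hav.2.2.1) (Ne.symm hbv.2.2.1)
    (Ne.symm hav.2.2.2) (Ne.symm hbv.2.2.2)
  have hxab := hS.adj_of_disjoint h.first hab (Ne.symm hav.1) (Ne.symm hbv.1)
    (Ne.symm hav.2.1) (Ne.symm hbv.2.1)
  have hfin : ∀ {a b}, H.Adj a b → [v, u, x₂, x₁, a, b].Nodup → G.Adj x₁ a → G.Adj v b →
      ∃ l : List V, l.IsChain G.Adj ∧ l.length ≤ 2 * k - 1 ∧
        ∀ p q, H.Adj p q → p ∈ l ∨ q ∈ l := by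
    intro a b hab hnd hxa hvb
    have hk4 : 4 ≤ k := by
      by_contra hcon
      -- for `k ≤ 3` the hexagon itself has a forbidden length
      refine not_closed_of_free hk hC (a := v) (b := b) (l := [u, x₂, x₁, a, b]) ?_ hnd
        (by simp) hvb.symm (by simp; omega) (by simp; omega)
      simp [(hS.1 h.last).symm, hadj2.symm, (hS.1 h.first).symm, hxa, hS.1 hab]
    exact exists_path_meeting_of_hexagon hk4 hC hS hab hxa.symm h.first hadj2 h.last hvb
      hnd
  have hab' := hab.ne
  have hnd1 : [v, u, x₂, x₁, a, b].Nodup := by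
    simp only [List.nodup_cons, List.mem_cons, List.not_mem_nil, List.nodup_nil] at hsix ⊢
    grind only
  have hnd2 : [v, u, x₂, x₁, b, a].Nodup := by
    simp only [List.nodup_cons, List.mem_cons, List.not_mem_nil, List.nodup_nil] at hsix ⊢
    grind only
  by_cases hxa : G.Adj x₁ a
  · exact hfin hab hnd1 hxa (by grind only)
  · exact hfin hab.symm hnd2 (by grind only) (by grind only)

/-- If the cycle lengths `2k`, `2k + 1`, `2k + 2` are forbidden, a path of `G` on at most `2k - 1`
vertices meets every edge of a strong clique. -/
theorem exists_path_meeting (hk : 2 ≤ k)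
    (hC : ∀ n, 2 * k ≤ n → n ≤ 2 * k + 2 → (cycleGraph n).Free G)
    (hS : IsStrongCliqueGraph G H) :
    ∃ l : List V, l.IsChain G.Adj ∧ l.length ≤ 2 * k - 1 ∧ ∀ p q, H.Adj p q → p ∈ l ∨ q ∈ l := by
  by_cases hne : ∃ a b, H.Adj a b
  swap
  · push Not at hne
    exact ⟨[], by simp, by simp, fun p q hpq => absurd hpq (hne p q)⟩
  obtain ⟨a, b, hab⟩ := hne
  by_cases hcover : ∀ p q, H.Adj p q → p ∈ [a, b] ∨ q ∈ [a, b]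
  · exact ⟨[a, b], by simp [hS.1 hab], by simp; omega, hcover⟩
  push Not at hcover
  obtain ⟨p, q, hpq, hp, hq⟩ := hcover
  simp only [List.mem_cons, List.not_mem_nil, or_false, not_or] at hp hq
  obtain ⟨x₁, x₂, u, v, hpath, -, -⟩ := exists_isCliquePath_nil hS hab hpq
    (Ne.symm hp.1) (Ne.symm hq.1) (Ne.symm hp.2) (Ne.symm hq.2)
  -- a path of maximal length among those on at most `2k + 1` vertices
  obtain ⟨m, hm, ⟨x₁, x₂, M, u, v, h, hlen⟩, hmax⟩ := exists_maximal_le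
    (P := fun n => ∃ x₁ x₂ M u v, IsCliquePath G H x₁ x₂ M u v ∧ M.length = n)
    (N := 2 * k - 3) (n := 0) (by omega) ⟨_, _, _, _, _, hpath, rfl⟩
  have hlt : ∀ {x₁ x₂ M' u' v'}, IsCliquePath G H x₁ x₂ M' u' v' → M'.length ≤ 2 * k - 3 →
      M'.length ≤ m := fun h' hle => hmax _ hle ⟨_, _, _, _, _, h', rfl⟩
  have hnodup := h.nodup
  have c0 := h.chain
  have c3 := h.chain_inner
  -- an edge missed by the path forces it to have `2k + 1` vertices
  have hmeet : m < 2 * k - 3 → ∀ p q, H.Adj p q →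
      p ∈ x₁ :: x₂ :: (M ++ [u, v]) ∨ q ∈ x₁ :: x₂ :: (M ++ [u, v]) := by
    intro hmlt p q hpq
    by_contra! hcon
    obtain ⟨M', u', v', h1, h2, -⟩ := h.extend hS hpq hcon.1 hcon.2
    have h3 := h1.length_ne hk hC hS
    have h4 := hlt h1
    omega
  rcases Nat.lt_or_ge m (2 * k - 4) with hlt' | hge
  · exact ⟨_, c0, by simp; omega, hmeet (by omega)⟩
  have hends : ¬ G.Adj x₁ v := fun h' =>
    not_closed_of_free hk hC c0 hnodup (by simp [List.getLast?_cons]) h'.symm (by simp; omega)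
      (by simp; omega)
  have hfirst : ∀ w, H.Adj x₁ w → w ∈ x₁ :: x₂ :: (M ++ [u, v]) := by
    intro w hw
    by_contra hcon
    have h1 := h.cons hS.1 hw hcon
    have h3 := h1.length_ne hk hC hS
    have h4 := hlt h1
    simp only [List.length_cons] at h3 h4
    omega
  have hlast : ∀ w, H.Adj v w → w ∈ x₁ :: x₂ :: (M ++ [u, v]) := by
    intro w hw
    by_contra hcon
    have h1 := h.snoc hS.1 hw hcon
    have h3 := h1.length_ne hk hC hS
    have h4 := hlt h1
    simp only [List.length_append, List.length_cons, List.length_nil] at h3 h4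
    omega
  have hinner : ∀ p q, H.Adj p q → (p ∈ x₁ :: x₂ :: (M ++ [u, v]) ∨
      q ∈ x₁ :: x₂ :: (M ++ [u, v])) → p ∈ x₂ :: (M ++ [u]) ∨ q ∈ x₂ :: (M ++ [u]) :=
    fun p q hpq => h.inner_meeting (fun h' => hends (hS.1 h')) hfirst hlast hpq
  by_cases hall : ∀ p q, H.Adj p q →
      p ∈ x₁ :: x₂ :: (M ++ [u, v]) ∨ q ∈ x₁ :: x₂ :: (M ++ [u, v])
  · exact ⟨_, c3, by simp; omega, fun p q hpq => hinner p q hpq (hall p q hpq)⟩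
  have hm3 : m = 2 * k - 3 := by
    by_contra hcon
    exact hall (hmeet (by omega))
  push Not at hall
  obtain ⟨a, b, hab, ha, hb⟩ := hall
  exact h.exists_path_meeting_of_missed hk hC hS (by omega) hab ha hb

end CliquePath

/-! ### Graphs without four-cycles -/

section FourCycle

open scoped Classical

variable {V : Type*} [Fintype V] {G H : SimpleGraph V} {Δ : ℕ}

/-- A vertex incident with three clique edges is on or adjacent to every clique edge: otherwise two
of its three clique neighbours would be adjacent to the same end of a clique edge it misses. -/
theorem eq_or_adj_of_three_le_degree (hG : (cycleGraph 4).Free G) (hS : IsStrongCliqueGraph G H)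
    {b x y : V} (hb : 3 ≤ H.degree b) (hxy : H.Adj x y) :
    b = x ∨ b = y ∨ G.Adj b x ∨ G.Adj b y := by
  by_contra! hcon
  obtain ⟨hbx, hby, hnx, hny⟩ := hcon
  rw [← card_neighborFinset_eq_degree] at hb
  obtain ⟨p, hp, q, hq, r, hr, hpq, hpr, hqr⟩ := Finset.two_lt_card.1 hb
  rw [mem_neighborFinset] at hp hq hr
  have key : ∀ p, H.Adj b p → G.Adj x p ∨ G.Adj y p := by
    intro p hp
    have hpx : p ≠ x := by rintro rfl; exact hnx (hS.1 hp)
    have hpy : p ≠ y := by rintro rfl; exact hny (hS.1 hp)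
    have := hS.adj_of_disjoint hp hxy hbx hby hpx hpy
    rcases this with h | h | h | h
    · exact absurd h hnx
    · exact absurd h hny
    · exact Or.inl h.symm
    · exact Or.inr h.symm
  have two : ∀ {p q z}, H.Adj b p → H.Adj b q → p ≠ q → b ≠ z → G.Adj z p → G.Adj z q → False :=
    fun hp hq hpq hbz h1 h2 => hpq (eq_of_common_neighbor hG hbz (hS.1 hp) h1 (hS.1 hq) h2)
  rcases key p hp with h1 | h1 <;> rcases key q hq with h2 | h2 <;> rcases key r hr with h3 | h3
  · exact two hp hq hpq hbx h1 h2
  · exact two hp hq hpq hbx h1 h2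
  · exact two hp hr hpr hbx h1 h3
  · exact two hq hr hqr hby h2 h3
  · exact two hq hr hqr hbx h2 h3
  · exact two hp hr hpr hby h1 h3
  · exact two hp hq hpq hby h1 h2
  · exact two hp hq hpq hby h1 h2

/-- Two vertices incident with at least three clique edges each are adjacent. -/
theorem adj_of_three_le_degree (hG : (cycleGraph 4).Free G) (hS : IsStrongCliqueGraph G H)
    {a b : V} (hab : a ≠ b) (ha : 3 ≤ H.degree a) (hb : 3 ≤ H.degree b) : G.Adj a b := by
  by_contra hcon
  rw [← card_neighborFinset_eq_degree] at hb
  obtain ⟨p, hp, q, hq, -, -, hpq, -, -⟩ := Finset.two_lt_card.1 hb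
  rw [mem_neighborFinset] at hp hq
  have key : ∀ p, H.Adj b p → G.Adj a p := by
    intro p hp
    rcases eq_or_adj_of_three_le_degree hG hS ha hp with h | h | h | h
    · exact absurd h hab
    · subst h; exact absurd (hS.1 hp.symm) hcon
    · exact absurd h hcon
    · exact h
  exact hpq (eq_of_common_neighbor hG hab (key p hp) (hS.1 hp) (key q hq) (hS.1 hq))

/-- A clique edge that misses two vertices of clique degree at least three contains a common
neighbour of them. -/
theorem exists_common_neighbor_of_three_le_degree (hG : (cycleGraph 4).Free G)
    (hS : IsStrongCliqueGraph G H) {a b x y : V} (hab : a ≠ b) (ha : 3 ≤ H.degree a)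
    (hb : 3 ≤ H.degree b) (hxy : H.Adj x y) (hax : a ≠ x) (hay : a ≠ y) (hbx : b ≠ x)
    (hby : b ≠ y) : (G.Adj a x ∧ G.Adj b x) ∨ (G.Adj a y ∧ G.Adj b y) := by
  have hadj := adj_of_three_le_degree hG hS hab ha hb
  have h1 := (eq_or_adj_of_three_le_degree hG hS ha hxy).resolve_left hax |>.resolve_left hay
  have h2 := (eq_or_adj_of_three_le_degree hG hS hb hxy).resolve_left hbx |>.resolve_left hby
  rcases h1 with h1 | h1 <;> rcases h2 with h2 | h2
  · exact Or.inl ⟨h1, h2⟩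
  · exact absurd (eq_of_common_neighbor hG hay hadj h2.symm h1 (hS.1 hxy).symm) hbx
  · exact absurd (eq_of_common_neighbor hG hax hadj h2.symm h1 (hS.1 hxy)) hby
  · exact Or.inr ⟨h1, h2⟩

theorem card_edgesMeeting_pair (hΔ : ∀ v, G.degree v ≤ Δ) {a b : V} (hab : G.Adj a b) :
    (edgesMeeting G {a, b}).card + 1 ≤ 2 * Δ := by
  have h := card_edgesMeeting_path G hΔ [a, b] (by simp [hab])
  simp only [List.toFinset_cons, List.toFinset_nil, insert_empty_eq, List.length_cons,
    List.length_nil] at h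
  omega

theorem card_edgeFinset_of_three_big (hG : (cycleGraph 4).Free G) (hS : IsStrongCliqueGraph G H)
    (hΔ : ∀ v, G.degree v ≤ Δ) {a b c : V} (hab : a ≠ b) (hac : a ≠ c) (hbc : b ≠ c)
    (ha : 3 ≤ H.degree a) (hb : 3 ≤ H.degree b) (hc : 3 ≤ H.degree c) :
    H.edgeFinset.card + 3 ≤ 3 * Δ := by
  have hAB := adj_of_three_le_degree hG hS hab ha hb
  have hAC := adj_of_three_le_degree hG hS hac ha hc
  have hBC := adj_of_three_le_degree hG hS hbc hb hc
  have hmeet : ∀ x y, H.Adj x y →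
      x ∈ ({a, b, c} : Finset V) ∨ y ∈ ({a, b, c} : Finset V) := by
    intro x y hxy
    by_contra! hcon
    simp only [Finset.mem_insert, Finset.mem_singleton, not_or] at hcon
    obtain ⟨⟨hxa, hxb, hxc⟩, hya, hyb, hyc⟩ := hcon
    -- the common neighbour of `a` and `b` can only be `c`
    rcases exists_common_neighbor_of_three_le_degree hG hS hab ha hb hxy (Ne.symm hxa)
      (Ne.symm hya) (Ne.symm hxb) (Ne.symm hyb) with h | h
    · exact hxc (eq_of_common_neighbor hG hab h.1 h.2 hAC hBC)
    · exact hyc (eq_of_common_neighbor hG hab h.1 h.2 hAC hBC)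
  rw [edgeFinset_eq_edgesMeeting hmeet]
  have h1 := Finset.card_le_card (edgesMeeting_mono hS.1 {a, b, c})
  have h2 := card_edgesMeeting_insert G {b, c} a
  have h3 := card_edgesMeeting_pair hΔ hBC
  have h4 : (({b, c} : Finset V).filter (G.Adj a)).card = 2 := by
    rw [Finset.filter_true_of_mem, Finset.card_pair hbc]
    simp [hAB, hAC]
  have h5 := hΔ a
  omega

theorem card_edgeFinset_of_two_big (hG : (cycleGraph 4).Free G) (hS : IsStrongCliqueGraph G H)
    (hΔ : ∀ v, G.degree v ≤ Δ) (h4 : 4 ≤ Δ) {a b : V} (hab : a ≠ b)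
    (ha : 3 ≤ H.degree a) (hb : 3 ≤ H.degree b)
    (hsmall : ∀ v, v ≠ a → v ≠ b → H.degree v ≤ 2) :
    H.edgeFinset.card + 3 ≤ 3 * Δ := by
  have hAB := adj_of_three_le_degree hG hS hab ha hb
  have h1 := Finset.card_le_card (edgesMeeting_mono hS.1 {a, b})
  have h3 := card_edgesMeeting_pair hΔ hAB
  by_cases hw : ∃ w, w ≠ a ∧ w ≠ b ∧ G.Adj a w ∧ G.Adj b w
  · obtain ⟨w, hwa, hwb, haw, hbw⟩ := hw
    have hmeet : ∀ x y, H.Adj x y →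
        x ∈ (insert w {a, b} : Finset V) ∨ y ∈ (insert w {a, b} : Finset V) := by
      intro x y hxy
      by_contra! hcon
      simp only [Finset.mem_insert, Finset.mem_singleton, not_or] at hcon
      obtain ⟨⟨hxw, hxa, hxb⟩, hyw, hya, hyb⟩ := hcon
      rcases exists_common_neighbor_of_three_le_degree hG hS hab ha hb hxy (Ne.symm hxa)
        (Ne.symm hya) (Ne.symm hxb) (Ne.symm hyb) with h | h
      · exact hxw (eq_of_common_neighbor hG hab h.1 h.2 haw hbw)
      · exact hyw (eq_of_common_neighbor hG hab h.1 h.2 haw hbw)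
    rw [edgeFinset_eq_edgesMeeting hmeet]
    have h5 := card_edgesMeeting_insert_le H {a, b} w
    have h6 := hsmall w hwa hwb
    omega
  · have hmeet : ∀ x y, H.Adj x y → x ∈ ({a, b} : Finset V) ∨ y ∈ ({a, b} : Finset V) := by
      intro x y hxy
      by_contra! hcon
      simp only [Finset.mem_insert, Finset.mem_singleton, not_or] at hcon
      obtain ⟨⟨hxa, hxb⟩, hya, hyb⟩ := hcon
      rcases exists_common_neighbor_of_three_le_degree hG hS hab ha hb hxy (Ne.symm hxa)
        (Ne.symm hya) (Ne.symm hxb) (Ne.symm hyb) with h | h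
      · exact hw ⟨x, hxa, hxb, h⟩
      · exact hw ⟨y, hya, hyb, h⟩
    rw [edgeFinset_eq_edgesMeeting hmeet]
    omega

theorem card_edgeFinset_of_one_big (hG : (cycleGraph 4).Free G) (hS : IsStrongCliqueGraph G H)
    (hΔ : ∀ v, G.degree v ≤ Δ) (h4 : 4 ≤ Δ) {a : V} (ha : 3 ≤ H.degree a)
    (hsmall : ∀ v, v ≠ a → H.degree v ≤ 2) :
    H.edgeFinset.card + 3 ≤ 3 * Δ := by
  have hmeet : ∀ x y, H.Adj x y → x ∈ G.neighborFinset a ∨ y ∈ G.neighborFinset a := by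
    intro x y hxy
    simp only [mem_neighborFinset]
    rcases eq_or_adj_of_three_le_degree hG hS ha hxy with rfl | rfl | h | h
    · exact Or.inr (hS.1 hxy)
    · exact Or.inl (hS.1 hxy.symm)
    · exact Or.inl h
    · exact Or.inr h
  rw [edgeFinset_eq_edgesMeeting hmeet]
  have h1 := card_edgesMeeting_le_sum H (G.neighborFinset a)
  have h2 : ∑ v ∈ G.neighborFinset a, H.degree v ≤ (G.neighborFinset a).card • 2 := by
    refine Finset.sum_le_card_nsmul _ _ _ fun v hv => hsmall v ?_
    rw [mem_neighborFinset] at hv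
    exact hv.ne'
  rw [card_neighborFinset_eq_degree, smul_eq_mul] at h2
  have h3 := hΔ a
  omega

/-- Two non-adjacent vertices incident with two clique edges each have a common clique neighbour. -/
theorem exists_common_clique_neighbor (hG : (cycleGraph 4).Free G) (hS : IsStrongCliqueGraph G H)
    {x w : V} (hxw : x ≠ w) (hx : 2 ≤ H.degree x) (hw : 2 ≤ H.degree w) (hn : ¬ G.Adj x w) :
    ∃ c, H.Adj x c ∧ H.Adj w c := by
  by_contra! hcon
  rw [← card_neighborFinset_eq_degree] at hx hw
  obtain ⟨p, hp, q, hq, hpq⟩ := Finset.one_lt_card.1 hx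
  obtain ⟨r, hr, s, hs, hrs⟩ := Finset.one_lt_card.1 hw
  rw [mem_neighborFinset] at hp hq hr hs
  have key : ∀ {p r}, H.Adj x p → H.Adj w r → G.Adj x r ∨ G.Adj w p ∨ G.Adj p r := by
    intro p r hp hr
    have hpw : p ≠ w := by rintro rfl; exact hn (hS.1 hp)
    have hxr : x ≠ r := by rintro rfl; exact hn (hS.1 hr).symm
    have hpr : p ≠ r := by rintro rfl; exact hcon p hp hr
    rcases hS.adj_of_disjoint hp hr hxw hxr hpw hpr with h | h | h | h
    · exact absurd h hn
    · exact Or.inl h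
    · exact Or.inr (Or.inl h.symm)
    · exact Or.inr (Or.inr h)
  -- a clique neighbour of one vertex adjacent to the other one closes a four-cycle
  have side : ∀ {x w p q r s}, x ≠ w → ¬ G.Adj x w → H.Adj x p → H.Adj x q → H.Adj w r →
      H.Adj w s → p ≠ q → r ≠ s → (∀ c, H.Adj x c → ¬ H.Adj w c) →
      (∀ {p r}, H.Adj x p → H.Adj w r → G.Adj x r ∨ G.Adj w p ∨ G.Adj p r) → ¬ G.Adj x r := by
    intro x w p q r s hxw hn hp hq hr hs hpq hrs hcon key hxr
    have uniq : ∀ t, G.Adj x t → G.Adj w t → t = r := fun t h1 h2 =>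
      eq_of_common_neighbor hG hxw h1 h2 hxr (hS.1 hr)
    have hxs : ¬ G.Adj x s := fun h => hrs (uniq s h (hS.1 hs)).symm
    have hH : ∀ t, H.Adj x t → ¬ G.Adj w t := by
      intro t h1 h2
      have := uniq t (hS.1 h1) h2
      subst this
      exact hcon t h1 hr
    have hps : G.Adj p s := ((key hp hs).resolve_left hxs).resolve_left (hH p hp)
    have hqs : G.Adj q s := ((key hq hs).resolve_left hxs).resolve_left (hH q hq)
    have hxs' : x = s :=
      eq_of_common_neighbor hG hpq (hS.1 hp).symm (hS.1 hq).symm hps hqs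
    subst hxs'
    exact hn (hS.1 hs).symm
  have hxr := side hxw hn hp hq hr hs hpq hrs hcon key
  have hxs := side hxw hn hp hq hs hr hpq hrs.symm hcon key
  have hwp := side hxw.symm (fun h => hn h.symm) hr hs hp hq hrs hpq (fun c h1 h2 => hcon c h2 h1)
    fun h1 h2 => by rcases key h2 h1 with h | h | h <;> simp [h, h.symm]
  have hpr := ((key hp hr).resolve_left hxr).resolve_left hwp
  have hps := ((key hp hs).resolve_left hxs).resolve_left hwp
  have hpw : p ≠ w := by rintro rfl; exact hn (hS.1 hp)
  exact hrs (eq_of_common_neighbor hG hpw hpr (hS.1 hr) hps (hS.1 hs))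

end FourCycle

section FourCycle

open scoped Classical

variable {V : Type*} [Fintype V] {G H : SimpleGraph V} {Δ : ℕ}

theorem two_le_degree_of_adj {x p q : V} (hpq : p ≠ q) (hp : H.Adj x p) (hq : H.Adj x q) :
    2 ≤ H.degree x := by
  rw [← card_neighborFinset_eq_degree]
  exact Finset.one_lt_card.2 ⟨p, by simpa using hp, q, by simpa using hq, hpq⟩

theorem three_le_degree_of_adj {x p q r : V} (hpq : p ≠ q) (hpr : p ≠ r) (hqr : q ≠ r)
    (hp : H.Adj x p) (hq : H.Adj x q) (hr : H.Adj x r) : 3 ≤ H.degree x := by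
  rw [← card_neighborFinset_eq_degree]
  exact Finset.two_lt_card.2
    ⟨p, by simpa using hp, q, by simpa using hq, r, by simpa using hr, hpq, hpr, hqr⟩

/-- Two non-adjacent neighbours of `x` of clique degree at least two are clique neighbours of `x`,
because `x` is their only common neighbour. -/
theorem clique_adj_of_not_adj (hG : (cycleGraph 4).Free G) (hS : IsStrongCliqueGraph G H)
    {x p q : V} (hpq : p ≠ q) (hp : 2 ≤ H.degree p) (hq : 2 ≤ H.degree q) (hxp : G.Adj x p)
    (hxq : G.Adj x q) (hn : ¬ G.Adj p q) : H.Adj x p ∧ H.Adj x q := by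
  obtain ⟨c, hpc, hqc⟩ := exists_common_clique_neighbor hG hS hpq hp hq hn
  have : c = x :=
    eq_of_common_neighbor hG hpq (hS.1 hpc) (hS.1 hqc) hxp.symm hxq.symm
  subst this
  exact ⟨hpc.symm, hqc.symm⟩

theorem card_neighbors_two_le_degree (hG : (cycleGraph 4).Free G) (hS : IsStrongCliqueGraph G H)
    {x : V} (hx : H.degree x ≤ 2) :
    ((G.neighborFinset x).filter fun u => 2 ≤ H.degree u).card ≤ 2 := by
  by_contra! hcon
  obtain ⟨p, hp, q, hq, r, hr, hpq, hpr, hqr⟩ := Finset.two_lt_card.1 hcon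
  simp only [Finset.mem_filter, mem_neighborFinset] at hp hq hr
  obtain ⟨hp, hp'⟩ := hp
  obtain ⟨hq, hq'⟩ := hq
  obtain ⟨hr, hr'⟩ := hr
  have uniq : ∀ {p q r}, G.Adj x p → G.Adj x q → G.Adj x r → G.Adj r p → G.Adj r q → p = q :=
    fun hp hq hr h1 h2 => eq_of_common_neighbor hG hr.ne hp h1 hq h2
  have hall : H.Adj x p ∧ H.Adj x q ∧ H.Adj x r := by
    by_cases h1 : G.Adj p q
    · have h2 : ¬ G.Adj p r := fun h => hqr (uniq hq hr hp h1 h)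
      have h3 : ¬ G.Adj q r := fun h => hpr (uniq hp hr hq h1.symm h)
      have h4 := clique_adj_of_not_adj hG hS hpr hp' hr' hp hr h2
      have h5 := clique_adj_of_not_adj hG hS hqr hq' hr' hq hr h3
      exact ⟨h4.1, h5.1, h4.2⟩
    · have h4 := clique_adj_of_not_adj hG hS hpq hp' hq' hp hq h1
      by_cases h2 : G.Adj p r
      · have h3 : ¬ G.Adj q r := fun h => hpq (uniq hp hq hr h2.symm h.symm)
        have h5 := clique_adj_of_not_adj hG hS hqr hq' hr' hq hr h3
        exact ⟨h4.1, h4.2, h5.2⟩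
      · have h5 := clique_adj_of_not_adj hG hS hpr hp' hr' hp hr h2
        exact ⟨h4.1, h4.2, h5.2⟩
  have := three_le_degree_of_adj hpq hpr hqr hall.1 hall.2.1 hall.2.2
  omega

/-- If every clique edge has an end of clique degree two, and no clique degree exceeds two, there
are at most nine clique edges. -/
theorem card_edgeFinset_le_nine (hG : (cycleGraph 4).Free G) (hS : IsStrongCliqueGraph G H)
    (hle : ∀ v, H.degree v ≤ 2) (hT : ∀ x y, H.Adj x y → 2 ≤ H.degree x ∨ 2 ≤ H.degree y)
    {v : V} (hv : 2 ≤ H.degree v) : H.edgeFinset.card ≤ 9 := by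
  set X := (G.neighborFinset v).filter fun u => 2 ≤ H.degree u with hX
  set D := Finset.univ.filter fun u => u ≠ v ∧ ¬ G.Adj v u ∧ 2 ≤ H.degree u with hD
  have hXc : X.card ≤ 2 := card_neighbors_two_le_degree hG hS (hle v)
  have hcommon : ∀ w ∈ D, ∃ c, H.Adj v c ∧ H.Adj w c := by
    intro w hw
    simp only [hD, Finset.mem_filter, Finset.mem_univ, true_and] at hw
    exact exists_common_clique_neighbor hG hS hw.1.symm hv hw.2.2 hw.2.1
  have hDc : D.card ≤ 2 := by
    have hsub : D ⊆ (H.neighborFinset v).biUnion fun c => (H.neighborFinset c).erase v := by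
      intro w hw
      obtain ⟨c, hvc, hwc⟩ := hcommon w hw
      simp only [hD, Finset.mem_filter, Finset.mem_univ, true_and] at hw
      simp only [Finset.mem_biUnion, mem_neighborFinset, Finset.mem_erase]
      exact ⟨c, hvc, hw.1, hwc.symm⟩
    refine (Finset.card_le_card hsub).trans ((Finset.card_biUnion_le_card_mul _ _ 1 ?_).trans ?_)
    · intro c hc
      rw [mem_neighborFinset] at hc
      rw [Finset.card_erase_of_mem (by simpa using hc.symm), card_neighborFinset_eq_degree]
      have := hle c
      omega
    · rw [card_neighborFinset_eq_degree, mul_one]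
      exact hle v
  have hmem : ∀ x, 2 ≤ H.degree x → x ∈ insert v (X ∪ D) := by
    intro x hx
    simp only [hX, hD, Finset.mem_insert, Finset.mem_union, Finset.mem_filter,
      mem_neighborFinset, Finset.mem_univ, true_and]
    tauto
  rw [edgeFinset_eq_edgesMeeting (W := insert v (X ∪ D))
    fun x y hxy => (hT x y hxy).imp (hmem x) (hmem y)]
  have hsum : ∀ W : Finset V, (edgesMeeting H W).card ≤ 2 * W.card := by
    intro W
    refine (card_edgesMeeting_le_sum H W).trans ?_
    rw [mul_comm]
    exact Finset.sum_le_card_nsmul _ _ _ fun v _ => hle v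
  have hU := hsum (X ∪ D)
  have hUc := Finset.card_union_le X D
  have hv2 := hle v
  rcases D.eq_empty_or_nonempty with h0 | ⟨w, hw⟩
  · have h1 := card_edgesMeeting_insert_le H (X ∪ D) v
    rw [h0, Finset.card_empty] at hUc
    rw [h0] at hU h1 ⊢
    omega
  · obtain ⟨c, hvc, hwc⟩ := hcommon w hw
    simp only [hD, Finset.mem_filter, Finset.mem_univ, true_and] at hw
    have hcX : c ∈ X ∪ D := by
      simp only [hX, Finset.mem_union, Finset.mem_filter, mem_neighborFinset]
      exact Or.inl ⟨hS.1 hvc, two_le_degree_of_adj hw.1 hwc.symm hvc.symm⟩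
    have h1 := card_edgesMeeting_insert_of_adj H hcX hvc
    omega

theorem card_edgesMeeting_le_card_add (hle : ∀ v, H.degree v ≤ 2) (W : Finset V) :
    (edgesMeeting H W).card ≤ W.card + (W.filter fun u => 2 ≤ H.degree u).card := by
  refine (card_edgesMeeting_le_sum H W).trans ?_
  rw [Finset.card_filter, Finset.card_eq_sum_ones, ← Finset.sum_add_distrib]
  refine Finset.sum_le_sum fun v _ => ?_
  have := hle v
  split_ifs <;> omega

/-- Let `xy` be a clique edge meeting no other clique edge at `x`. If `y` has a further neighbour of
clique degree two, then at most one more clique edge meets the further neighbours of `x` than there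
are such neighbours. -/
theorem card_edgesMeeting_neighbors (hG : (cycleGraph 4).Free G) (hS : IsStrongCliqueGraph G H)
    (hle : ∀ v, H.degree v ≤ 2) {x y q : V} (hxy : H.Adj x y) (hx : ∀ z, H.Adj x z → z = y)
    (hyq : G.Adj y q) (hqx : q ≠ x) (hq : 2 ≤ H.degree q) :
    (edgesMeeting H ((G.neighborFinset x).erase y)).card
      ≤ ((G.neighborFinset x).erase y).card + 1 := by
  set A := (G.neighborFinset x).erase y with hA
  have hW := card_edgesMeeting_le_card_add hle A
  by_cases hc : (A.filter fun u => 2 ≤ H.degree u).card ≤ 1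
  · omega
  push Not at hc
  obtain ⟨p, hp, p', hp', hpp⟩ := Finset.one_lt_card.1 hc
  have hpA := (Finset.mem_filter.1 hp).1
  have hpA' := (Finset.mem_filter.1 hp').1
  simp only [hA, Finset.mem_filter, Finset.mem_erase, mem_neighborFinset] at hp hp'
  obtain ⟨⟨hpy, hxp⟩, hpd⟩ := hp
  obtain ⟨⟨hpy', hxp'⟩, hpd'⟩ := hp'
  have hadj : G.Adj p p' := by
    by_contra hn
    exact hpy (hx p (clique_adj_of_not_adj hG hS hpp hpd hpd' hxp hxp' hn).1)
  have hny : ∀ {p p'}, G.Adj x p → G.Adj x p' → p' ≠ y → G.Adj p p' → ¬ G.Adj y p := by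
    intro p p' h1 h2 h3 h4 h5
    exact h3 (eq_of_common_neighbor hG h1.ne h2 h4 (hS.1 hxy) h5.symm)
  have hqp : q ≠ p := by rintro rfl; exact hny hxp hxp' hpy' hadj hyq
  have hqp' : q ≠ p' := by rintro rfl; exact hny hxp' hxp hpy hadj.symm hyq
  have hnq : ∀ {t}, G.Adj x t → t ≠ y → ¬ G.Adj q t := by
    intro t h1 h2 h3
    exact h2 (eq_of_common_neighbor hG hqx h3 h1 hyq.symm (hS.1 hxy))
  obtain ⟨c, hqc, hpc⟩ := exists_common_clique_neighbor hG hS hqp hq hpd (hnq hxp hpy)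
  obtain ⟨c', hqc', hpc'⟩ := exists_common_clique_neighbor hG hS hqp' hq hpd' (hnq hxp' hpy')
  have hcc : c ≠ c' := by
    rintro rfl
    have : c = x :=
      eq_of_common_neighbor hG hpp (hS.1 hpc) (hS.1 hpc') hxp.symm hxp'.symm
    subst this
    exact hpy (hx p hpc.symm)
  have hcp' : c ≠ p' := by rintro rfl; exact hnq hxp' hpy' (hS.1 hqc)
  have hncp : ¬ G.Adj c p' := fun h =>
    hcc (eq_of_common_neighbor hG hqp' (hS.1 hqc) h.symm (hS.1 hqc') (hS.1 hpc'))
  obtain ⟨g, hcg, hpg⟩ := exists_common_clique_neighbor hG hS hcp'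
    (two_le_degree_of_adj hqp hqc.symm hpc.symm) hpd' hncp
  have hgq : g ≠ q := by rintro rfl; exact hnq hxp' hpy' (hS.1 hpg).symm
  have hgp : g = p := by
    by_contra hgp
    have h1 := three_le_degree_of_adj hqp (Ne.symm hgq) (Ne.symm hgp) hqc.symm hpc.symm hcg
    have h2 := hle c
    omega
  subst hgp
  have hpe : p' ∈ A.erase g := Finset.mem_erase.2 ⟨hpp.symm, hpA'⟩
  have h1 := card_edgesMeeting_insert_of_adj H hpe hpg.symm
  rw [Finset.insert_erase hpA] at h1
  have h2 := card_edgesMeeting_le_card_add hle (A.erase g)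
  have h3 : ((A.erase g).filter fun u => 2 ≤ H.degree u).card ≤ 1 := by
    rw [Finset.filter_erase, Finset.card_erase_of_mem (Finset.mem_filter.2 ⟨hpA, hpd⟩)]
    have h4 : (A.filter fun u => 2 ≤ H.degree u).card ≤ 2 := by
      refine (Finset.card_le_card ?_).trans (card_neighbors_two_le_degree hG hS (hle x))
      exact Finset.filter_subset_filter _ (Finset.erase_subset _ _)
    omega
  have h5 := Finset.card_erase_add_one hpA
  have h6 := hle g
  omega

/-- If no clique degree exceeds two and some clique edge meets no other clique edge, there are at
most `2Δ + 1` clique edges. -/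
theorem card_edgeFinset_of_isolated (hG : (cycleGraph 4).Free G) (hS : IsStrongCliqueGraph G H)
    (hΔ : ∀ v, G.degree v ≤ Δ) (hle : ∀ v, H.degree v ≤ 2) {x y : V} (hxy : H.Adj x y)
    (hx : H.degree x ≤ 1) (hy : H.degree y ≤ 1) : H.edgeFinset.card ≤ 2 * Δ + 1 := by
  have hx' : ∀ z, H.Adj x z → z = y := by
    intro z hz
    by_contra hne
    have := two_le_degree_of_adj hne hz hxy
    omega
  have hy' : ∀ z, H.Adj y z → z = x := by
    intro z hz
    by_contra hne
    have := two_le_degree_of_adj hne hz hxy.symm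
    omega
  have hGxy := hS.1 hxy
  set A := (G.neighborFinset x).erase y with hA
  set B := (G.neighborFinset y).erase x with hB
  have hAc : A.card + 1 ≤ Δ := by
    rw [hA, Finset.card_erase_add_one (by simpa using hGxy), card_neighborFinset_eq_degree]
    exact hΔ x
  have hBc : B.card + 1 ≤ Δ := by
    rw [hB, Finset.card_erase_add_one (by simpa using hGxy.symm), card_neighborFinset_eq_degree]
    exact hΔ y
  have hmeet : ∀ p q, H.Adj p q → p ∈ insert x (A ∪ B) ∨ q ∈ insert x (A ∪ B) := by
    intro p q hpq
    by_cases hpx : p = x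
    · exact Or.inl (by simp [hpx])
    by_cases hqx : q = x
    · exact Or.inr (by simp [hqx])
    have hpy : p ≠ y := by rintro rfl; exact hqx (hy' q hpq)
    have hqy : q ≠ y := by rintro rfl; exact hpx (hy' p hpq.symm)
    have := hS.adj_of_disjoint hxy hpq (Ne.symm hpx) (Ne.symm hqx) hpy.symm hqy.symm
    simp only [hA, hB, Finset.mem_insert, Finset.mem_union, Finset.mem_erase, mem_neighborFinset]
    tauto
  rw [edgeFinset_eq_edgesMeeting hmeet]
  have h1 := card_edgesMeeting_insert_le H (A ∪ B) x
  rw [edgesMeeting_union] at h1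
  have h2 := Finset.card_union_le (edgesMeeting H A) (edgesMeeting H B)
  have hAm := card_edgesMeeting_le_card_add hle A
  have hBm := card_edgesMeeting_le_card_add hle B
  have hA2 : (A.filter fun u => 2 ≤ H.degree u).card ≤ 2 :=
    (Finset.card_le_card (Finset.filter_subset_filter _ (Finset.erase_subset _ _))).trans
      (card_neighbors_two_le_degree hG hS (hle x))
  have hB2 : (B.filter fun u => 2 ≤ H.degree u).card ≤ 2 :=
    (Finset.card_le_card (Finset.filter_subset_filter _ (Finset.erase_subset _ _))).trans
      (card_neighbors_two_le_degree hG hS (hle y))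
  rcases (A.filter fun u => 2 ≤ H.degree u).eq_empty_or_nonempty with h0 | ⟨p, hp⟩
  · rw [h0, Finset.card_empty] at hAm
    omega
  rcases (B.filter fun u => 2 ≤ H.degree u).eq_empty_or_nonempty with h0 | ⟨q, hq⟩
  · rw [h0, Finset.card_empty] at hBm
    omega
  simp only [hA, hB, Finset.mem_filter, Finset.mem_erase, mem_neighborFinset] at hp hq
  have h3 := card_edgesMeeting_neighbors hG hS hle hxy hx' hq.1.2 hq.1.1 hq.2
  have h4 := card_edgesMeeting_neighbors hG hS hle hxy.symm hy' hp.1.2 hp.1.1 hp.2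
  rw [← hA] at h3
  rw [← hB] at h4
  omega

/-- A strong clique of a graph without four-cycles of maximum degree at most `Δ`, where `4 ≤ Δ`, has
at most `3 (Δ - 1)` edges. -/
theorem card_edgeFinset_of_fourCycle_free (hG : (cycleGraph 4).Free G)
    (hS : IsStrongCliqueGraph G H) (hΔ : ∀ v, G.degree v ≤ Δ) (h4 : 4 ≤ Δ) :
    H.edgeFinset.card + 3 ≤ 3 * Δ := by
  by_cases h1 : ∃ a, 3 ≤ H.degree a
  · obtain ⟨a, ha⟩ := h1
    by_cases h2 : ∃ b, b ≠ a ∧ 3 ≤ H.degree b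
    · obtain ⟨b, hba, hb⟩ := h2
      by_cases h3 : ∃ c, c ≠ a ∧ c ≠ b ∧ 3 ≤ H.degree c
      · obtain ⟨c, hca, hcb, hc⟩ := h3
        exact card_edgeFinset_of_three_big hG hS hΔ hba.symm hca.symm hcb.symm ha hb hc
      · push Not at h3
        exact card_edgeFinset_of_two_big hG hS hΔ h4 hba.symm ha hb
          fun v hva hvb => Nat.le_of_lt_succ (h3 v hva hvb)
    · push Not at h2
      exact card_edgeFinset_of_one_big hG hS hΔ h4 ha fun v hva => Nat.le_of_lt_succ (h2 v hva)
  push Not at h1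
  have hle : ∀ v, H.degree v ≤ 2 := fun v => Nat.le_of_lt_succ (h1 v)
  by_cases hiso : ∃ x y, H.Adj x y ∧ H.degree x ≤ 1 ∧ H.degree y ≤ 1
  · obtain ⟨x, y, hxy, hx, hy⟩ := hiso
    have := card_edgeFinset_of_isolated hG hS hΔ hle hxy hx hy
    omega
  have hT : ∀ x y, H.Adj x y → 2 ≤ H.degree x ∨ 2 ≤ H.degree y := by
    intro x y hxy
    by_contra! hcon
    exact hiso ⟨x, y, hxy, by omega, by omega⟩
  by_cases hv : ∃ v, 2 ≤ H.degree v
  · obtain ⟨v, hv⟩ := hv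
    have := card_edgeFinset_le_nine hG hS hle hT hv
    omega
  · push Not at hv
    have : H.edgeFinset = ∅ := by
      rw [edgeFinset_eq_edgesMeeting (W := ∅), edgesMeeting_empty]
      intro a b hab
      rcases hT a b hab with h | h
      · exact absurd h (by have := hv a; omega)
      · exact absurd h (by have := hv b; omega)
    rw [this, Finset.card_empty]
    omega

end FourCycle

/-! ### One forbidden even cycle -/

section EvenCycle

open scoped Classical

variable {V : Type*} {G H F : SimpleGraph V} {k : ℕ}

/-- The sum of the degrees of the subgraph of `F` induced on `S`. -/
noncomputable def inducedDegreeSum (F : SimpleGraph V) (S : Finset V) : ℕ :=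
  ∑ v ∈ S, (S.filter (F.Adj v)).card

/-- A graph of average degree more than `2t` has a nonempty induced subgraph of minimum degree more
than `t`. -/
theorem exists_subset_min_degree (t : ℕ) (S : Finset V)
    (hS : 2 * t * S.card < inducedDegreeSum F S) :
    ∃ S' ⊆ S, S'.Nonempty ∧ ∀ v ∈ S', t < (S'.filter (F.Adj v)).card := by
  induction S using Finset.strongInduction with
  | H S ih =>
    by_cases hall : ∀ v ∈ S, t < (S.filter (F.Adj v)).card
    · refine ⟨S, Finset.Subset.refl S, ?_, hall⟩
      rw [Finset.nonempty_iff_ne_empty]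
      rintro rfl
      simp [inducedDegreeSum] at hS
    push Not at hall
    obtain ⟨v, hv, hdeg⟩ := hall
    -- deleting `v` lowers the degree sum by twice the degree of `v`
    have hsum : inducedDegreeSum F S =
        inducedDegreeSum F (S.erase v) + 2 * (S.filter (F.Adj v)).card := by
      have h1 : ∀ u ∈ S.erase v, (S.filter (F.Adj u)).card =
          ((S.erase v).filter (F.Adj u)).card + if F.Adj v u then 1 else 0 := by
        intro u _
        rw [Finset.filter_erase]
        split_ifs with h
        · exact (Finset.card_erase_add_one (Finset.mem_filter.2 ⟨hv, h.symm⟩)).symm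
        · rw [Finset.erase_eq_of_notMem, add_zero]
          exact fun h' => h (Finset.mem_filter.1 h').2.symm
      have h2 : ∑ u ∈ S.erase v, (if F.Adj v u then 1 else 0) = (S.filter (F.Adj v)).card := by
        rw [← Finset.card_filter, Finset.filter_erase, Finset.erase_eq_of_notMem]
        simp
      unfold inducedDegreeSum
      rw [← Finset.add_sum_erase S _ hv, Finset.sum_congr rfl h1, Finset.sum_add_distrib, h2]
      omega
    have hcard := Finset.card_erase_add_one hv
    obtain ⟨S', hS', h⟩ := ih (S.erase v) (Finset.erase_ssubset hv) (by
      rw [← hcard, mul_add] at hS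
      omega)
    exact ⟨S', hS'.trans (Finset.erase_subset _ _), h⟩

/-- In a graph of minimum degree more than `t` every vertex is the last one of a path on `t + 2`
vertices. -/
theorem exists_path_of_min_degree {t : ℕ} {S : Finset V}
    (hS : ∀ v ∈ S, t < (S.filter (F.Adj v)).card) {v : V} (hv : v ∈ S) {n : ℕ} (hn : n ≤ t + 1) :
    ∃ u l, (u :: l).IsChain F.Adj ∧ (u :: l).Nodup ∧ l.length = n ∧
      (u :: l).getLast? = some v ∧ ∀ x ∈ u :: l, x ∈ S := by
  induction n with
  | zero => exact ⟨v, [], by simp, by simp, rfl, by simp, by simpa using hv⟩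
  | succ n ih =>
    obtain ⟨u, l, h1, h2, h3, h4, h5⟩ := ih (by omega)
    have hex : ∃ w ∈ S.filter (F.Adj u), w ∉ l.toFinset := by
      by_contra! hcon
      have := Finset.card_le_card (fun w hw => hcon w hw)
      have h6 := List.toFinset_card_le l
      have h7 := hS u (h5 u (by simp))
      omega
    obtain ⟨w, hw, hwl⟩ := hex
    rw [Finset.mem_filter] at hw
    rw [List.mem_toFinset] at hwl
    refine ⟨w, u :: l, List.isChain_cons_cons.2 ⟨hw.2.symm, h1⟩, List.nodup_cons.2 ⟨?_, h2⟩,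
      by simp [h3], ?_, ?_⟩
    · rw [List.mem_cons, not_or]
      exact ⟨hw.2.ne', hwl⟩
    · simpa [List.getLast?_cons] using h4
    · intro x hx
      rcases List.mem_cons.1 hx with rfl | hx
      · exact hw.1
      · exact h5 x hx

/-- A graph of average degree more than `2t` on `S` contains a path on `t + 2` vertices ending in a
vertex with a prescribed property, provided every vertex without the property has only neighbours
with it. -/
theorem exists_path_of_inducedDegreeSum {t : ℕ} {S : Finset V}
    (hS : 2 * t * S.card < inducedDegreeSum F S) {P : V → Prop}
    (hP : ∀ v w, F.Adj v w → ¬ P v → P w) :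
    ∃ u l v, (u :: l).IsChain F.Adj ∧ (u :: l).Nodup ∧ l.length = t + 1 ∧
      (u :: l).getLast? = some v ∧ P v ∧ ∀ x ∈ u :: l, x ∈ S := by
  obtain ⟨S', hS', ⟨v, hv⟩, hdeg⟩ := exists_subset_min_degree t S hS
  have hstart : ∃ v ∈ S', P v := by
    by_cases hPv : P v
    · exact ⟨v, hv, hPv⟩
    · obtain ⟨w, hw⟩ := Finset.card_pos.1 (lt_of_le_of_lt (Nat.zero_le t) (hdeg v hv))
      rw [Finset.mem_filter] at hw
      exact ⟨w, hw.1, hP v w hw.2 hPv⟩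
  obtain ⟨v, hv, hPv⟩ := hstart
  obtain ⟨u, l, h1, h2, h3, h4, h5⟩ := exists_path_of_min_degree hdeg hv le_rfl
  exact ⟨u, l, v, h1, h2, h3, h4, hPv, fun x hx => hS' (h5 x hx)⟩

/-- Along a path whose edges all switch the property `P`, the ends agree on `P` if the number of
edges is even. -/
theorem chain_parity {P : V → Prop} (hF : ∀ v w, F.Adj v w → (P v ↔ ¬ P w)) {u v : V}
    {l : List V} (hl : (u :: l).IsChain F.Adj) (hlast : (u :: l).getLast? = some v) (hv : P v) :
    P u ↔ Even l.length := by
  induction l generalizing u with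
  | nil =>
    simp only [List.getLast?_singleton, Option.some.injEq] at hlast
    subst hlast
    simpa using hv
  | cons w l ih =>
    rw [List.isChain_cons_cons] at hl
    have := ih hl.2 (by simpa [List.getLast?_cons] using hlast)
    rw [hF u w hl.1, this, List.length_cons, Nat.even_add_one]

/-- The pairs in `K` are pairwise disjoint edges of `H`. -/
def IsMatchingPairs (H : SimpleGraph V) (K : Finset (V × V)) : Prop :=
  (∀ p ∈ K, H.Adj p.1 p.2) ∧
    ∀ p ∈ K, ∀ q ∈ K, p ≠ q → p.1 ≠ q.1 ∧ p.1 ≠ q.2 ∧ p.2 ≠ q.1 ∧ p.2 ≠ q.2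

theorem IsMatchingPairs.mono {K K' : Finset (V × V)} (h : IsMatchingPairs H K) (hK : K' ⊆ K) :
    IsMatchingPairs H K' :=
  ⟨fun p hp => h.1 p (hK hp), fun p hp q hq => h.2 p (hK hp) q (hK hq)⟩

theorem IsMatchingPairs.fst_injOn {K : Finset (V × V)} (h : IsMatchingPairs H K) :
    Set.InjOn Prod.fst (K : Set (V × V)) := by
  intro p hp q hq hpq
  by_contra hne
  exact (h.2 p hp q hq hne).1 hpq

theorem IsMatchingPairs.snd_injOn {K : Finset (V × V)} (h : IsMatchingPairs H K) :
    Set.InjOn Prod.snd (K : Set (V × V)) := by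
  intro p hp q hq hpq
  by_contra hne
  exact (h.2 p hp q hq hne).2.2.2 hpq

theorem IsMatchingPairs.fst_ne_snd {K : Finset (V × V)} (h : IsMatchingPairs H K) {p q : V × V}
    (hp : p ∈ K) (hq : q ∈ K) : p.1 ≠ q.2 := by
  by_cases hpq : p = q
  · subst hpq; exact (h.1 p hp).ne
  · exact (h.2 p hp q hq hpq).2.1

/-- Reversing some of the pairs of a matching gives a matching of the same size. -/
theorem IsMatchingPairs.image_flip {K : Finset (V × V)} (h : IsMatchingPairs H K)
    {f : V × V → V × V} (hf : ∀ p, f p = p ∨ f p = p.swap) :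
    IsMatchingPairs H (K.image f) ∧ (K.image f).card = K.card := by
  have hne : ∀ p ∈ K, ∀ q ∈ K, p ≠ q → (f p).1 ≠ (f q).1 ∧ (f p).1 ≠ (f q).2 ∧
      (f p).2 ≠ (f q).1 ∧ (f p).2 ≠ (f q).2 := by
    intro p hp q hq hpq
    obtain ⟨h1, h2, h3, h4⟩ := h.2 p hp q hq hpq
    rcases hf p with hp' | hp' <;> rcases hf q with hq' | hq' <;> rw [hp', hq'] <;>
      simp [h1, h2, h3, h4]
  refine ⟨⟨?_, ?_⟩, Finset.card_image_of_injOn ?_⟩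
  · intro r hr
    obtain ⟨p, hp, rfl⟩ := Finset.mem_image.1 hr
    rcases hf p with hp' | hp' <;> rw [hp']
    · exact h.1 p hp
    · exact (h.1 p hp).symm
  · intro r hr s hs hpq
    obtain ⟨p, hp, rfl⟩ := Finset.mem_image.1 hr
    obtain ⟨q, hq, rfl⟩ := Finset.mem_image.1 hs
    exact hne p hp q hq fun h' => hpq (by rw [h'])
  · intro p hp q hq hpq
    by_contra hcon
    exact (hne p hp q hq hcon).1 (by rw [hpq])

theorem inducedDegreeSum_image {ι : Type*} {f : ι → V} {K : Finset ι}
    (hf : Set.InjOn f (K : Set ι)) :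
    inducedDegreeSum F (K.image f) = ∑ p ∈ K, ∑ q ∈ K, if F.Adj (f p) (f q) then 1 else 0 := by
  unfold inducedDegreeSum
  rw [Finset.sum_image hf]
  refine Finset.sum_congr rfl fun p _ => ?_
  rw [Finset.card_filter, Finset.sum_image hf]

/-- Let `K` be a matching of clique edges whose first vertices are neighbours of a vertex `x` off
the matching. If `G` has no cycle of length `2k`, then `K` has at most `16k - 27` edges: the edges
of `G` among the first vertices, among the second vertices, and between them are all sparse, since a
long path of any of the three kinds closes up through `x`. -/
theorem IsMatchingPairs.card_le_of_star (hk : 3 ≤ k) (hG : (cycleGraph (2 * k)).Free G)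
    (hS : IsStrongCliqueGraph G H) {K : Finset (V × V)} (hK : IsMatchingPairs H K) {x : V}
    (hx : ∀ p ∈ K, G.Adj x p.1) (hx2 : ∀ p ∈ K, x ≠ p.2) : K.card + 27 ≤ 16 * k := by
  set N := K.image Prod.fst with hN
  set N' := K.image Prod.snd with hN'
  have hNc : N.card = K.card := Finset.card_image_of_injOn hK.fst_injOn
  have hNc' : N'.card = K.card := Finset.card_image_of_injOn hK.snd_injOn
  have hNx : ∀ v ∈ N, G.Adj x v := by
    intro v hv
    obtain ⟨p, hp, rfl⟩ := Finset.mem_image.1 hv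
    exact hx p hp
  have hNx' : x ∉ N' := by
    intro hv
    obtain ⟨p, hp, h⟩ := Finset.mem_image.1 hv
    exact hx2 p hp h.symm
  have hxN : x ∉ N := fun h => (hNx x h).ne rfl
  have hdisj : Disjoint N N' := by
    rw [Finset.disjoint_left]
    intro v hv hv'
    obtain ⟨p, hp, rfl⟩ := Finset.mem_image.1 hv
    obtain ⟨q, hq, h⟩ := Finset.mem_image.1 hv'
    exact hK.fst_ne_snd hp hq h.symm
  have nocycle : ∀ {a b : V} {l : List V}, (a :: l).IsChain G.Adj → (a :: l).Nodup →
      (a :: l).getLast? = some b → G.Adj b a → l.length + 1 = 2 * k → False := by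
    intro a b l h1 h2 h3 h4 h5
    have := cycleGraph_isContained_of_list h1 h2 h3 h4 (by simp; omega)
    rw [List.length_cons, h5] at this
    exact hG this
  -- paths on `2k - 1` vertices with both ends in `N`
  have hclose : ∀ {u v : V} {l : List V}, (u :: l).IsChain G.Adj → (u :: l).Nodup →
      l.length = 2 * k - 3 + 1 → (u :: l).getLast? = some v → u ∈ N → v ∈ N →
      x ∉ u :: l → False := by
    intro u v l h1 h2 h3 h4 hu hv hxl
    refine nocycle (a := x) (b := v) (l := u :: l) (List.isChain_cons_cons.2 ⟨hNx u hu, h1⟩)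
      (List.nodup_cons.2 ⟨hxl, h2⟩) ?_ (hNx v hv).symm (by simp; omega)
    simpa [List.getLast?_cons] using h4
  have hD1 : inducedDegreeSum G N ≤ 2 * (2 * k - 3) * N.card := by
    by_contra! hcon
    obtain ⟨u, l, v, h1, h2, h3, h4, hPv, h5⟩ :=
      exists_path_of_inducedDegreeSum hcon (P := fun _ => True) (fun _ _ _ _ => trivial)
    exact hclose h1 h2 h3 h4 (h5 u (by simp)) (h5 v (List.mem_of_getLast? h4))
      fun h => hxN (h5 x h)
  -- a path on `2k - 3` vertices in `N'` is closed through two matching edges and `x`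
  have hD2 : inducedDegreeSum G N' ≤ 2 * (2 * k - 5) * N'.card := by
    by_contra! hcon
    obtain ⟨u, l, v, h1, h2, h3, h4, hPv, h5⟩ :=
      exists_path_of_inducedDegreeSum hcon (P := fun _ => True) (fun _ _ _ _ => trivial)
    obtain ⟨p, hp, hpu⟩ := Finset.mem_image.1 (h5 u (by simp))
    obtain ⟨q, hq, hqv⟩ := Finset.mem_image.1 (h5 v (List.mem_of_getLast? h4))
    have hpq : p ≠ q := by
      rintro rfl
      rw [hpu] at hqv
      subst hqv
      cases l with
      | nil => simp at h3
      | cons w l =>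
        rw [List.getLast?_cons_cons] at h4
        exact (List.nodup_cons.1 h2).1 (List.mem_of_getLast? h4)
    have hmem : ∀ r ∈ K, r.1 ∉ u :: l := fun r hr h =>
      Finset.disjoint_left.1 hdisj (Finset.mem_image_of_mem _ hr) (h5 _ h)
    have hpu' : G.Adj p.1 u := hpu ▸ hS.1 (hK.1 p hp)
    have hvq : G.Adj v q.1 := hqv ▸ (hS.1 (hK.1 q hq)).symm
    have hx1 := hmem p hp
    have hx2 := hmem q hq
    have hx3 : x ∉ u :: l := fun h => hNx' (h5 x h)
    refine nocycle (a := x) (b := q.1) (l := p.1 :: (u :: l ++ [q.1])) ?_ ?_ ?_ (hx q hq).symm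
      (by simp; omega)
    · refine List.isChain_cons_cons.2 ⟨hx p hp, ?_⟩
      rw [List.cons_append, List.isChain_cons_cons, ← List.cons_append]
      refine ⟨hpu', h1.append (by simp) ?_⟩
      rw [h4]
      simpa using hvq
    · refine List.nodup_cons.2 ⟨?_, List.nodup_cons.2 ⟨?_, List.Nodup.append h2 (by simp) ?_⟩⟩
      · rw [List.mem_cons, List.mem_append, List.mem_singleton]
        rintro (h | h | h)
        · exact (hx p hp).ne h
        · exact hx3 h
        · exact (hx q hq).ne h
      · rw [List.mem_append, List.mem_singleton]
        rintro (h | h)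
        · exact hx1 h
        · exact (hK.2 p hp q hq hpq).1 h
      · rw [List.disjoint_singleton]
        exact hx2
    · simp [List.getLast?_cons]
  -- the bipartite graph between `N` and `N'`
  obtain ⟨F, hFadj⟩ : ∃ F : SimpleGraph V, ∀ a b,
      F.Adj a b ↔ G.Adj a b ∧ (a ∈ N ∧ b ∈ N' ∨ a ∈ N' ∧ b ∈ N) :=
    ⟨{ Adj := fun a b => G.Adj a b ∧ (a ∈ N ∧ b ∈ N' ∨ a ∈ N' ∧ b ∈ N)
       symm := ⟨fun a b h => ⟨h.1.symm, by tauto⟩⟩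
       loopless := ⟨fun a h => h.1.ne rfl⟩ }, fun _ _ => Iff.rfl⟩
  have hFswitch : ∀ a b, F.Adj a b → (a ∈ N ↔ ¬ b ∈ N) := by
    intro a b hab
    rcases ((hFadj a b).1 hab).2 with h | h
    · have := Finset.disjoint_right.1 hdisj h.2
      tauto
    · have := Finset.disjoint_right.1 hdisj h.1
      tauto
  have hD3 : inducedDegreeSum F (N ∪ N') ≤ 2 * (2 * k - 3) * (N ∪ N').card := by
    by_contra! hcon
    obtain ⟨u, l, v, h1, h2, h3, h4, hPv, h5⟩ :=
      exists_path_of_inducedDegreeSum hcon (P := (· ∈ N))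
        fun v w hvw hv => by have := hFswitch v w hvw; tauto
    have hu : u ∈ N := by
      rw [chain_parity hFswitch h1 h4 hPv, h3]
      exact ⟨k - 1, by omega⟩
    refine hclose (h1.imp fun a b h => ((hFadj a b).1 h).1) h2 h3 h4 hu hPv fun h => ?_
    rcases Finset.mem_union.1 (h5 x h) with h | h
    · exact hxN h
    · exact hNx' h
  have hUc : (N ∪ N').card = 2 * K.card := by
    rw [Finset.card_union_of_disjoint hdisj, hNc, hNc']; omega
  have hE1 := inducedDegreeSum_image (F := G) hK.fst_injOn
  have hE2 := inducedDegreeSum_image (F := G) hK.snd_injOn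
  have hE3 : ∑ p ∈ K, ∑ q ∈ K, (if G.Adj p.1 q.2 then 1 else 0) +
      ∑ p ∈ K, ∑ q ∈ K, (if G.Adj p.2 q.1 then 1 else 0) ≤ inducedDegreeSum F (N ∪ N') := by
    unfold inducedDegreeSum
    rw [Finset.sum_union hdisj, hN, hN', Finset.sum_image hK.fst_injOn,
      Finset.sum_image hK.snd_injOn, ← hN, ← hN']
    refine add_le_add (Finset.sum_le_sum fun p hp => ?_) (Finset.sum_le_sum fun p hp => ?_)
    · rw [← Finset.card_filter]
      rw [← Finset.card_image_of_injOn (f := Prod.snd)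
        (hK.snd_injOn.mono (Finset.coe_subset.2 (Finset.filter_subset _ _)))]
      refine Finset.card_le_card fun v hv => ?_
      obtain ⟨q, hq, rfl⟩ := Finset.mem_image.1 hv
      rw [Finset.mem_filter] at hq
      have h1 : p.1 ∈ N := Finset.mem_image_of_mem _ hp
      have h2 : q.2 ∈ N' := Finset.mem_image_of_mem _ hq.1
      exact Finset.mem_filter.2 ⟨Finset.mem_union_right _ h2, (hFadj _ _).2 ⟨hq.2, Or.inl ⟨h1, h2⟩⟩⟩
    · rw [← Finset.card_filter]
      rw [← Finset.card_image_of_injOn (f := Prod.fst)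
        (hK.fst_injOn.mono (Finset.coe_subset.2 (Finset.filter_subset _ _)))]
      refine Finset.card_le_card fun v hv => ?_
      obtain ⟨q, hq, rfl⟩ := Finset.mem_image.1 hv
      rw [Finset.mem_filter] at hq
      have h1 : p.2 ∈ N' := Finset.mem_image_of_mem _ hp
      have h2 : q.1 ∈ N := Finset.mem_image_of_mem _ hq.1
      exact Finset.mem_filter.2 ⟨Finset.mem_union_left _ h2, (hFadj _ _).2 ⟨hq.2, Or.inr ⟨h1, h2⟩⟩⟩
  -- every pair of distinct matching edges is joined by an edge of one of the kinds
  have hcount : K.card * (K.card - 1) ≤ inducedDegreeSum G N + inducedDegreeSum G N' +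
      inducedDegreeSum F (N ∪ N') := by
    refine le_trans ?_ (Nat.add_le_add_left hE3 _)
    rw [hN, hN', hE1, hE2, ← Finset.sum_add_distrib, ← Finset.sum_add_distrib,
      ← Finset.sum_add_distrib, ← smul_eq_mul]
    refine Finset.card_nsmul_le_sum _ _ _ fun p hp => ?_
    rw [← Finset.sum_add_distrib, ← Finset.sum_add_distrib, ← Finset.sum_add_distrib,
      ← Finset.card_erase_of_mem hp]
    refine le_trans ?_ (Finset.sum_le_sum_of_subset (Finset.erase_subset p K))
    rw [Finset.card_eq_sum_ones]
    refine Finset.sum_le_sum fun q hq => ?_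
    rw [Finset.mem_erase] at hq
    obtain ⟨h1, h2, h3, h4⟩ := hK.2 p hp q hq.2 hq.1.symm
    rcases hS.adj_of_disjoint (hK.1 p hp) (hK.1 q hq.2) h1 h2 h3 h4 with h | h | h | h <;>
      simp only [h, if_true] <;> omega
  rw [hNc] at hD1
  rw [hNc'] at hD2
  rw [hUc] at hD3
  by_contra! hcon
  obtain ⟨j, rfl⟩ := Nat.exists_eq_add_of_le hk
  obtain ⟨i, hi⟩ := Nat.exists_eq_add_of_le (show 16 * (3 + j) - 26 ≤ K.card by omega)
  have e1 : 2 * (3 + j) - 3 = 2 * j + 3 := by omega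
  have e2 : 2 * (3 + j) - 5 = 2 * j + 1 := by omega
  have e3 : K.card = 16 * j + 22 + i := by omega
  rw [e1] at hD1 hD3
  rw [e2] at hD2
  have e4 : K.card - 1 = 16 * j + 21 + i := by omega
  rw [e4] at hcount
  have hpos : 0 < K.card := by omega
  have : K.card * (16 * j + 21 + i) ≤ K.card * (16 * j + 20) := by
    nlinarith
  have := Nat.le_of_mul_le_mul_left this hpos
  omega

/-- Without cycles of length `2k`, a matching inside a strong clique has at most `32k - 53` edges:
at least half of the other matching edges are joined to the same end of a given one. -/
theorem IsMatchingPairs.card_le (hk : 3 ≤ k) (hG : (cycleGraph (2 * k)).Free G)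
    (hS : IsStrongCliqueGraph G H) {K : Finset (V × V)} (hK : IsMatchingPairs H K) :
    K.card + 53 ≤ 32 * k := by
  rcases K.eq_empty_or_nonempty with rfl | ⟨p, hp⟩
  · rw [Finset.card_empty]; omega
  have half : ∀ x, (∀ q ∈ K.erase p, x ≠ q.1 ∧ x ≠ q.2) →
      ((K.erase p).filter fun q => G.Adj x q.1 ∨ G.Adj x q.2).card + 27 ≤ 16 * k := by
    intro x hx
    set A := (K.erase p).filter fun q => G.Adj x q.1 ∨ G.Adj x q.2 with hA
    have hAK : A ⊆ K.erase p := Finset.filter_subset _ _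
    let f : V × V → V × V := fun q => if G.Adj x q.1 then q else q.swap
    have hf : ∀ q, f q = q ∨ f q = q.swap := by
      intro q
      by_cases h : G.Adj x q.1 <;> simp [f, h]
    obtain ⟨h1, h2⟩ := (hK.mono (hAK.trans (Finset.erase_subset p K))).image_flip hf
    rw [← h2]
    refine h1.card_le_of_star hk hG hS (x := x) ?_ ?_
    · intro r hr
      obtain ⟨q, hq, rfl⟩ := Finset.mem_image.1 hr
      have h3 := (Finset.mem_filter.1 hq).2
      by_cases h : G.Adj x q.1
      · simp [f, h]
      · simpa [f, h] using h3
    · intro r hr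
      obtain ⟨q, hq, rfl⟩ := Finset.mem_image.1 hr
      have h3 := hx q (hAK hq)
      rcases hf q with h | h <;> rw [h]
      · exact h3.2
      · exact h3.1
  have h1 := half p.1 fun q hq => by
    rw [Finset.mem_erase] at hq
    obtain ⟨h1, h2, h3, h4⟩ := hK.2 p hp q hq.2 hq.1.symm
    exact ⟨h1, h2⟩
  have h2 := half p.2 fun q hq => by
    rw [Finset.mem_erase] at hq
    obtain ⟨h1, h2, h3, h4⟩ := hK.2 p hp q hq.2 hq.1.symm
    exact ⟨h3, h4⟩
  have hsub : K.erase p ⊆ ((K.erase p).filter fun q => G.Adj p.1 q.1 ∨ G.Adj p.1 q.2) ∪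
      (K.erase p).filter fun q => G.Adj p.2 q.1 ∨ G.Adj p.2 q.2 := by
    intro q hq
    have hq' := Finset.mem_erase.1 hq
    obtain ⟨h1, h2, h3, h4⟩ := hK.2 p hp q hq'.2 hq'.1.symm
    have := hS.adj_of_disjoint (hK.1 p hp) (hK.1 q hq'.2) h1 h2 h3 h4
    simp only [Finset.mem_union, Finset.mem_filter]
    tauto
  have h3 := (Finset.card_le_card hsub).trans (Finset.card_union_le _ _)
  have h4 := Finset.card_erase_add_one hp
  omega

/-- The vertices of a matching of `ν` clique edges are met by at most `2ν (Δ - 1) + 1` edges of `G`: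
the matching edges and the edges joining them are counted at both of their ends. -/
theorem IsMatchingPairs.card_edgesMeeting [Fintype V] (hS : IsStrongCliqueGraph G H) {Δ : ℕ}
    (hΔ : ∀ v, G.degree v ≤ Δ) (K : Finset (V × V)) (hK : IsMatchingPairs H K) :
    (edgesMeeting G (K.image Prod.fst ∪ K.image Prod.snd)).card + 2 * K.card
      ≤ 2 * K.card * Δ + 1 := by
  induction K using Finset.induction_on with
  | empty => simp [edgesMeeting_empty]
  | insert p K hp ih =>
    have ih := ih (hK.mono (Finset.subset_insert _ _))
    set W := K.image Prod.fst ∪ K.image Prod.snd with hW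
    have hWe : (insert p K).image Prod.fst ∪ (insert p K).image Prod.snd =
        insert p.1 (insert p.2 W) := by
      rw [Finset.image_insert, Finset.image_insert, Finset.insert_union, Finset.union_insert]
    rw [hWe, Finset.card_insert_of_notMem hp]
    have hadj : G.Adj p.1 p.2 := hS.1 (hK.1 p (Finset.mem_insert_self _ _))
    have hd1 := hΔ p.1
    have hd2 := hΔ p.2
    have g1 := card_edgesMeeting_insert_of_adj G (Finset.mem_insert_self p.2 W) hadj
    have g2 := card_edgesMeeting_insert_le G W p.2
    have hmul : 2 * (K.card + 1) * Δ = 2 * K.card * Δ + 2 * Δ := by ring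
    rw [hmul]
    rcases K.eq_empty_or_nonempty with h0 | ⟨q, hq⟩
    · have : (edgesMeeting G W).card = 0 := by
        rw [hW, h0]; simp [edgesMeeting_empty]
      rw [h0, Finset.card_empty]
      omega
    have hpq : p ≠ q := fun h => hp (h ▸ hq)
    have hp' := Finset.mem_insert_self p K
    have hq' := Finset.mem_insert_of_mem (b := p) hq
    obtain ⟨h1, h2, h3, h4⟩ := hK.2 p hp' q hq' hpq
    have hq1 : q.1 ∈ W := Finset.mem_union_left _ (Finset.mem_image_of_mem _ hq)
    have hq2 : q.2 ∈ W := Finset.mem_union_right _ (Finset.mem_image_of_mem _ hq)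
    have first : ∀ z ∈ W, p.2 ≠ z → G.Adj p.1 z →
        (edgesMeeting G (insert p.1 (insert p.2 W))).card + 2 * (K.card + 1)
          ≤ 2 * K.card * Δ + 2 * Δ + 1 := by
      intro z hz hne hpz
      have g3 := card_edgesMeeting_insert G (insert p.2 W) p.1
      have g4 : 1 < ((insert p.2 W).filter (G.Adj p.1)).card :=
        Finset.one_lt_card.2 ⟨p.2, by simp [hadj], z, by simp [hz, hpz], hne⟩
      omega
    have second : ∀ z ∈ W, G.Adj p.2 z →
        (edgesMeeting G (insert p.1 (insert p.2 W))).card + 2 * (K.card + 1)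
          ≤ 2 * K.card * Δ + 2 * Δ + 1 := by
      intro z hz hpz
      have g3 := card_edgesMeeting_insert_of_adj G hz hpz
      omega
    rcases hS.adj_of_disjoint (hK.1 p hp') (hK.1 q hq') h1 h2 h3 h4 with h | h | h | h
    · exact first _ hq1 h3 h
    · exact first _ hq2 h4 h
    · exact second _ hq1 h
    · exact second _ hq2 h

/-- The vertices of a maximum matching of `H` meet every edge of `H`. -/
theorem exists_isMatchingPairs_meeting [Fintype V] (H : SimpleGraph V) :
    ∃ K : Finset (V × V), IsMatchingPairs H K ∧ ∀ a b, H.Adj a b →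
      a ∈ K.image Prod.fst ∪ K.image Prod.snd ∨ b ∈ K.image Prod.fst ∪ K.image Prod.snd := by
  obtain ⟨K, hK, hmax⟩ := Finset.exists_max_image
    (Finset.univ.filter fun K : Finset (V × V) => IsMatchingPairs H K) Finset.card
    ⟨∅, by simp [IsMatchingPairs]⟩
  rw [Finset.mem_filter] at hK
  refine ⟨K, hK.2, fun a b hab => ?_⟩
  by_contra! hcon
  obtain ⟨ha, hb⟩ := hcon
  have hne : ∀ q ∈ K, a ≠ q.1 ∧ a ≠ q.2 ∧ b ≠ q.1 ∧ b ≠ q.2 := by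
    intro q hq
    have h1 : q.1 ∈ K.image Prod.fst ∪ K.image Prod.snd :=
      Finset.mem_union_left _ (Finset.mem_image_of_mem _ hq)
    have h2 : q.2 ∈ K.image Prod.fst ∪ K.image Prod.snd :=
      Finset.mem_union_right _ (Finset.mem_image_of_mem _ hq)
    refine ⟨?_, ?_, ?_, ?_⟩ <;> intro h
    · exact ha (h ▸ h1)
    · exact ha (h ▸ h2)
    · exact hb (h ▸ h1)
    · exact hb (h ▸ h2)
  have hnot : (a, b) ∉ K := fun h => (hne _ h).1 rfl
  have hins : IsMatchingPairs H (insert (a, b) K) := by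
    refine ⟨?_, ?_⟩
    · intro p hp
      rcases Finset.mem_insert.1 hp with rfl | hp
      · exact hab
      · exact hK.2.1 p hp
    · intro p hp q hq hpq
      rcases Finset.mem_insert.1 hp with rfl | hp <;> rcases Finset.mem_insert.1 hq with rfl | hq
      · exact absurd rfl hpq
      · exact hne q hq
      · obtain ⟨h1, h2, h3, h4⟩ := hne p hp
        exact ⟨h1.symm, h3.symm, h2.symm, h4.symm⟩
      · exact hK.2.2 p hp q hq hpq
  have := hmax _ (Finset.mem_filter.2 ⟨Finset.mem_univ _, hins⟩)
  rw [Finset.card_insert_of_notMem hnot] at this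
  omega

end EvenCycle

/-! ### The bounds on the strong clique number -/

section Bounds

open scoped Classical

variable {V : Type*} [Fintype V] {G : SimpleGraph V} {Δ k : ℕ}

theorem exists_strongCliqueGraph_card_eq (G : SimpleGraph V) :
    ∃ H : SimpleGraph V, IsStrongCliqueGraph G H ∧ H.edgeFinset.card = strongCliqueNumber G := by
  obtain ⟨S, hS, hcard⟩ := (isGreatest_strongCliqueNumber G).1
  obtain ⟨H, hH, h⟩ := exists_strongCliqueGraph S hS
  exact ⟨H, hH, h.trans hcard⟩

theorem strongCliqueNumber_le_of_fourCycle_free (hG : (cycleGraph 4).Free G)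
    (hΔ : ∀ v, G.degree v ≤ Δ) (h4 : 4 ≤ Δ) : strongCliqueNumber G + 3 ≤ 3 * Δ := by
  obtain ⟨H, hH, h⟩ := exists_strongCliqueGraph_card_eq G
  rw [← h]
  exact card_edgeFinset_of_fourCycle_free hG hH hΔ h4

/-- Here `m` is the size of a maximum matching contained in a largest strong clique. -/
theorem strongCliqueNumber_le_of_evenCycle_free (hk : 3 ≤ k) (hG : (cycleGraph (2 * k)).Free G)
    (hΔ : ∀ v, G.degree v ≤ Δ) :
    ∃ m, m + 53 ≤ 32 * k ∧ strongCliqueNumber G + 2 * m ≤ 2 * m * Δ + 1 := by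
  obtain ⟨H, hH, h⟩ := exists_strongCliqueGraph_card_eq G
  obtain ⟨K, hK, hmeet⟩ := exists_isMatchingPairs_meeting H
  refine ⟨K.card, hK.card_le hk hG hH, ?_⟩
  rw [← h, edgeFinset_eq_edgesMeeting hmeet]
  exact (Nat.add_le_add_right (Finset.card_le_card (edgesMeeting_mono hH.1 _)) _).trans
    (hK.card_edgesMeeting hH hΔ)

/-- Here `m` is the number of vertices of a path that meets every edge of a largest strong
clique. -/
theorem strongCliqueNumber_le_of_three_cycles_free (hk : 2 ≤ k)
    (hC : ∀ n, 2 * k ≤ n → n ≤ 2 * k + 2 → (cycleGraph n).Free G) (hΔ : ∀ v, G.degree v ≤ Δ) :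
    ∃ m, m ≤ 2 * k - 1 ∧ strongCliqueNumber G + m ≤ m * Δ + 1 := by
  obtain ⟨H, hH, h⟩ := exists_strongCliqueGraph_card_eq G
  obtain ⟨l, hl, hlen, hmeet⟩ := exists_path_meeting hk hC hH
  refine ⟨l.length, hlen, ?_⟩
  rw [← h, edgeFinset_eq_edgesMeeting (W := l.toFinset) (by simpa using hmeet)]
  exact (Nat.add_le_add_right (Finset.card_le_card (edgesMeeting_mono hH.1 _)) _).trans
    (card_edgesMeeting_path G hΔ l hl)

end Bounds

theorem mainTheorem2 {V : Type*} [Fintype V] (G : SimpleGraph V) [DecidableRel G.Adj]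
    (Δ : ℕ) (hΔ : G.maxDegree = Δ) :
    (4 ≤ Δ → (SimpleGraph.cycleGraph 4).Free G →
      (strongCliqueNumber G : ℤ) ≤ 3 * ((Δ : ℤ) - 1)) ∧
    (∀ k : ℕ, 3 ≤ k → 2 ≤ Δ → (SimpleGraph.cycleGraph (2 * k)).Free G →
      (strongCliqueNumber G : ℤ) ≤ 10 * (k : ℤ) ^ 2 * ((Δ : ℤ) - 1)) ∧
    (∀ k : ℕ, 2 ≤ k → 1 ≤ Δ →
      (SimpleGraph.cycleGraph (2 * k)).Free G →
      (SimpleGraph.cycleGraph (2 * k + 1)).Free G →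
      (SimpleGraph.cycleGraph (2 * k + 2)).Free G →
      (strongCliqueNumber G : ℤ) ≤ (2 * (k : ℤ) - 1) * ((Δ : ℤ) - 1) + 2) := by
  classical
  have hdeg := fun v => hΔ ▸ G.degree_le_maxDegree v
  refine ⟨fun h4 hG => ?_, fun k hk h2 hG => ?_, fun k hk h1 hC0 hC1 hC2 => ?_⟩
  · have := strongCliqueNumber_le_of_fourCycle_free hG (Δ := Δ)
      (fun v => by convert hdeg v) h4
    omega
  · obtain ⟨m, hm, h⟩ := strongCliqueNumber_le_of_evenCycle_free hk hG (Δ := Δ)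
      (fun v => by convert hdeg v)
    zify at h hm h2 hk
    -- `2 (32k - 53) + 1 ≤ 10k²`
    have h3 : (2 * (m : ℤ) + 1) ≤ 10 * (k : ℤ) ^ 2 := by nlinarith [sq_nonneg ((k : ℤ) - 3)]
    nlinarith
  · have hC : ∀ n, 2 * k ≤ n → n ≤ 2 * k + 2 → (cycleGraph n).Free G := by
      intro n h1 h2
      have : n = 2 * k ∨ n = 2 * k + 1 ∨ n = 2 * k + 2 := by omega
      rcases this with rfl | rfl | rfl
      · exact hC0
      · exact hC1
      · exact hC2
    obtain ⟨m, hm, h⟩ := strongCliqueNumber_le_of_three_cycles_free hk hC (Δ := Δ)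
      (fun v => by convert hdeg v)
    have hm' : (m : ℤ) ≤ 2 * k - 1 := by omega
    zify at h h1
    nlinarith
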